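/- **Setting.** For an $n\times m$ integer matrix $C=(c_{ik})$ with $n\ge m$ and no zero rows, let $l_i(u)=\sum_{k} c_{ik}u_k$ be the linear forms given by its rows, and let $S_C\subseteq\mathbb C^m$ be the Zariski closure of the image of the rational map $$\psi_C:\mathbb C^m\dashrightarrow\mathbb C^m,\qquad \psi_C(u)_k=\prod_{i=1}^n l_i(u)^{c_{ik}}\quad(k=1,\dots,m).$$ $C$ is called *regular* if each of its columns sums to $0$, and *non-defective* if $S_C$ has codimension $1$ in $\mathbb C^m$. In that case $\Delta_C\in\mathbb Z[y_1,\dots,y_m]$ denotes an irreducible equation of $S_C$ with integer coefficients and content $1$ (it is defined up to sign): $\Delta_C$ is irreducible in $\mathbb C[y_1,\dots,y_m]$, its zero set in $\mathbb C^m$ is $S_C$, and the gcd of its coefficients is $1$. For $M\in\mathbb Z^{m\times m}$ let $\alpha_M:(\mathbb C^*)^m\to(\mathbb C^*)^m$, $\alpha_M(y)_k=\prod_{i=1}^m y_i^{M_{ik}}$, let $G_M=\{\varepsilon\in(\mathbb C^*)^m:\alpha_M(\varepsilon)=(1,\dots,1)\}$ with coordinatewise multiplication, and let $\mathbb ZM\subseteq\mathbb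 Z^m$ be the lattice spanned by the columns of $M$. **Theorem.** Let $C_1,C_2$ be non-defective regular $n\times m$ integer matrices without zero rows, $n\ge m$, such that $C_1=C_2\cdot M$ for some $M\in\mathbb Z^{m\times m}$. Then the group $G_M$ is finite, the polynomials $\Delta_{C_1}$ and $\Delta_{C_2}$ exist, and, whatever the choice of their signs: 1. There is a vector $v\in\mathbb ZM$ such that, in the Laurent polynomial ring $\mathbb C[y_1^{\pm1},\dots,y_m^{\pm1}]$, $$\Delta_{C_1}(\alpha_M(y))=\pm\,y^v\prod_{\varepsilon\in G_M}\Delta_{C_2}(\varepsilon\cdot y).$$ 2. The polynomials $\Delta_{C_2}(\varepsilon\cdot y)$, $\varepsilon\in G_M$, are pairwise coprime in $\mathbb C[y_1,\dots,y_m]$, and each of them divides $\Delta_{C_1}(\alpha_M(y))$ with multiplicity exactly one in the Laurent polynomial ring. Moreover, a vector $w\in\mathbb Z^m$ lies in $\mathbb ZM$ if and only if $\varepsilon^w=1$ for all $\varepsilon\in G_M$. -/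

import Mathlib

namespace HornKapranov

open MvPolynomial

variable {n m : ℕ}

/-- The linear form `l_i(u) = ⟨C_i, u⟩` given by the `i`-th row of `C`. -/
def linearForm (C : Matrix (Fin n) (Fin m) ℤ) (i : Fin n) (u : Fin m → ℂ) : ℂ :=
  ∑ k, (C i k : ℂ) * u k

/-- The Horn–Kapranov parametrization `ψ_C`, with coordinates `y_k = ∏ i, l_i(u) ^ c_{ik}`;
it is only used where no `l_i` vanishes. -/
noncomputable def psi (C : Matrix (Fin n) (Fin m) ℤ) (u : Fin m → ℂ) : Fin m → ℂ :=
  fun k => ∏ i, linearForm C i u ^ C i k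

/-- The image of `ψ_C` on the complement of the hyperplanes `l_i = 0`. When `C` has no zero row
this complement is a nonempty Zariski open set, hence dense in every domain of definition of the
rational map `ψ_C`, so that the closure of the image does not depend on this choice. -/
def psiImage (C : Matrix (Fin n) (Fin m) ℤ) : Set (Fin m → ℂ) :=
  psi C '' {u | ∀ i, linearForm C i u ≠ 0}

/-- `S_C ⊆ ℂ^m`: the Zariski closure of the image of `ψ_C`. -/
def S (C : Matrix (Fin n) (Fin m) ℤ) : Set (Fin m → ℂ) :=
  zeroLocus ℂ (vanishingIdeal ℂ (psiImage C))

/-- `C` is regular: each of its columns sums to zero (its row vectors add up to `0`). -/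
def IsRegular (C : Matrix (Fin n) (Fin m) ℤ) : Prop :=
  ∀ k, ∑ i, C i k = 0

/-- `C` is non-defective: `S_C` has codimension one in `ℂ^m`. The codimension of an irreducible
closed set is the height of its (prime) vanishing ideal. -/
def NonDefective (C : Matrix (Fin n) (Fin m) ℤ) : Prop :=
  (vanishingIdeal ℂ (S C) : Ideal (MvPolynomial (Fin m) ℂ)).height = 1

/-- The image in `ℂ[y]` of a polynomial with integer coefficients. -/
noncomputable def toComplex (Δ : MvPolynomial (Fin m) ℤ) : MvPolynomial (Fin m) ℂ :=
  map (Int.castRingHom ℂ) Δ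

/-- `Δ` is a generalized inhomogeneous discriminant `Δ_C`: an irreducible equation of `S_C` with
integer coefficients and content `1`. (This determines `Δ` up to sign.) -/
def IsDiscriminant (C : Matrix (Fin n) (Fin m) ℤ) (Δ : MvPolynomial (Fin m) ℤ) : Prop :=
  Irreducible (toComplex Δ) ∧
  {y : Fin m → ℂ | eval y (toComplex Δ) = 0} = S C ∧
  (Δ.support.gcd fun a => Δ.coeff a) = 1

/-- The monomial map `α_M : (ℂ^*)^m → (ℂ^*)^m`, `α_M(y)_k = ∏ i, y_i ^ M_{ik}`. -/
def alpha (M : Matrix (Fin m) (Fin m) ℤ) : (Fin m → ℂˣ) →* (Fin m → ℂˣ) where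
  toFun y := fun k => ∏ i, y i ^ M i k
  map_one' := by funext k; simp
  map_mul' x y := by funext k; simp [mul_zpow, Finset.prod_mul_distrib]

/-- The group `G_M = {ε ∈ (ℂ^*)^m : α_M(ε) = 1}`. -/
def G (M : Matrix (Fin m) (Fin m) ℤ) : Subgroup (Fin m → ℂˣ) :=
  (alpha M).ker

/-- The lattice `ℤM ⊆ ℤ^m` spanned by the columns of `M`. -/
def columnLattice (M : Matrix (Fin m) (Fin m) ℤ) : Submodule ℤ (Fin m → ℤ) :=
  Submodule.span ℤ (Set.range M.col)

/-- The Laurent polynomial ring `ℂ[y_1^{±1}, …, y_m^{±1}]`. -/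
abbrev Laurent (m : ℕ) : Type := AddMonoidAlgebra ℂ (Fin m → ℤ)

/-- The Laurent monomial `y^v`. -/
noncomputable def mono (v : Fin m → ℤ) : Laurent m :=
  AddMonoidAlgebra.single v 1

/-- The inclusion of `ℂ[y_1, …, y_m]` into the Laurent polynomial ring. -/
noncomputable def toLaurent : MvPolynomial (Fin m) ℂ →ₐ[ℂ] Laurent m :=
  aeval fun k => mono (Pi.single k 1)

/-- `f ↦ f ∘ α_M`: substitute `y^{M^{(k)}}` for `y_k`, with `M^{(k)}` the `k`-th column of `M`. -/
noncomputable def compAlpha (M : Matrix (Fin m) (Fin m) ℤ) :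
    MvPolynomial (Fin m) ℂ →ₐ[ℂ] Laurent m :=
  aeval fun k => mono (M.col k)

/-- The polynomial `f(ε · y)`, for the coordinatewise action of `ε` in the torus. -/
noncomputable def scale (ε : Fin m → ℂˣ) :
    MvPolynomial (Fin m) ℂ →ₐ[ℂ] MvPolynomial (Fin m) ℂ :=
  aeval fun k => C (ε k : ℂ) * X k

end HornKapranov

/-!
Since `l_i ∘ M` are the linear forms of `C * M`, the parametrization `ψ_{CM}` is `α_M ∘ ψ_C ∘ M`.
A regular `C` with non-defective `ψ_C` has trivial kernel, because the generic fibre of `ψ_C` is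
the line spanned by the Euler vector field; hence `M` is nonsingular, and `G_M` is dual to
`ℤ^m / ℤM`.

The map `ψ_C` is inverse to the logarithmic Gauss map of the hypersurface `Δ_C = 0`: the matrix
`∂ log ψ_k / ∂u_a` is symmetric, so the logarithmic gradient of `Δ_C` along `ψ_C` is tangent to
the fibres, that is, proportional to `u`. If `Δ_C(ε · y)` is associated to `Δ_C`, the Gauss map
takes the same value at `y` and `ε · y`, which forces `ε = 1`. So the factors `Δ_C(ε · y)` are
pairwise coprime.

Their product is `G_M`-invariant, so its exponents lie in `ℤM` and it is the pullback under `α_M`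
of a Laurent polynomial, which vanishes on the image of `ψ_{CM}` and is therefore divisible by
`Δ_{CM}`. Conversely each factor divides `Δ_{CM}(α_M(y))`. The two sides thus differ by a unit
`c y^v`.

The constant `c` is rational, because the leading coefficient of the product is a power of that of
`Δ_C` up to the product of the values of a character of `G_M`, which is `±1`. By Gauss's lemma
over the ring of algebraic integers both sides have content `1`, so `c` and `c⁻¹` are integral and
`c = ±1`.

For existence over `ℤ`, apply a `ℚ`-linear functional `ℂ → ℚ` to the coefficients of an equation
of `S_C`. The resulting rational polynomial still vanishes at the images under `ψ_C` of rational
points, which are dense in `S_C`, and its degree is no larger, so it is an equation of `S_C` as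
well.
-/

namespace HornKapranov

open MvPolynomial

variable {n m : ℕ}

section Derivation

theorem derivation_aeval {R A ι : Type*} [CommRing R] [CommRing A] [Algebra R A] [Fintype ι]
    (D : Derivation R A A) (x : ι → A) (f : MvPolynomial ι R) :
    D (aeval x f) = ∑ i, aeval x (pderiv i f) * D (x i) := by
  classical
  induction f using MvPolynomial.induction_on with
  | C a => simp
  | add p q hp hq => simp only [map_add, hp, hq, add_mul, Finset.sum_add_distrib]
  | mul_X p j hp =>
    have hX (i : ι) : aeval x (pderiv i (p * X j)) * D (x i) =
        aeval x p * (if i = j then D (x j) else 0) + x j * (aeval x (pderiv i p) * D (x i)) := by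
      obtain rfl | h := eq_or_ne i j
      · simp [add_mul, mul_assoc]
      · simp [h, pderiv_X_of_ne h.symm, mul_assoc]
    rw [map_mul, aeval_X, Derivation.leibniz, hp]
    simp only [hX, Finset.sum_add_distrib,
      ← Finset.mul_sum, smul_eq_mul, Finset.sum_ite_eq', Finset.mem_univ, if_true]

theorem exists_derivation_fractionRing {R σ : Type*} [CommRing R]
    (h : σ → FractionRing (MvPolynomial σ R)) :
    ∃ D : Derivation R (FractionRing (MvPolynomial σ R)) (FractionRing (MvPolynomial σ R)),
      ∀ i, D (algebraMap _ _ (X i : MvPolynomial σ R)) = h i := by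
  let A := MvPolynomial σ R
  let b := (KaehlerDifferential.mvPolynomialBasis R σ).ofIsLocalizedModule (FractionRing A)
    (nonZeroDivisors A) (KaehlerDifferential.map R R A (FractionRing A))
  refine ⟨(b.constr R h).compDer (KaehlerDifferential.D R (FractionRing A)), fun i => ?_⟩
  have hb : b i = KaehlerDifferential.D R _ (algebraMap A (FractionRing A) (X i)) := by
    rw [Module.Basis.ofIsLocalizedModule_apply, KaehlerDifferential.mvPolynomialBasis_apply,
      KaehlerDifferential.map_D]
  calc (b.constr R h) (KaehlerDifferential.D R _ (algebraMap A _ (X i)))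
      = b.constr R h (b i) := by rw [hb]
    _ = h i := b.constr_basis R h i

theorem derivation_prod_zpow {R K ι : Type*} [CommRing R] [Field K] [Algebra R K]
    (D : Derivation R K K) (s : Finset ι) {x : ι → K} (e : ι → ℤ) (hx : ∀ i ∈ s, x i ≠ 0) :
    D (∏ i ∈ s, x i ^ e i) = (∏ i ∈ s, x i ^ e i) * ∑ i ∈ s, e i * (D (x i) / x i) := by
  classical
  induction s using Finset.induction_on with
  | empty => simp
  | insert a s ha ih =>
    have hxa := hx a (Finset.mem_insert_self _ _)
    rw [Finset.prod_insert ha, Finset.sum_insert ha, Derivation.leibniz,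
      ih fun i hi => hx i (Finset.mem_insert_of_mem hi), Derivation.leibniz_zpow]
    simp only [smul_eq_mul, zsmul_eq_mul, zpow_sub_one₀ hxa]
    field_simp
    ring

variable {k K : Type*} [Field k] [Field K] [Algebra k K]

theorem derivation_eq_zero_of_mem_adjoin {D : Derivation k K K} {s : Set K}
    (hs : ∀ x ∈ s, D x = 0) {x : K} (hx : x ∈ IntermediateField.adjoin k s) : D x = 0 := by
  induction hx using IntermediateField.adjoin_induction with
  | mem x h => exact hs x h
  | algebraMap x => exact D.map_algebraMap x
  | add x y _ _ hx hy => rw [map_add, hx, hy, add_zero]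
  | inv x _ hx => rw [Derivation.leibniz_inv, hx, smul_zero]
  | mul x y _ _ hx hy => rw [Derivation.leibniz, hx, hy, smul_zero, smul_zero, add_zero]

theorem derivation_eq_zero_of_isAlgebraic [CharZero k] {D : Derivation k K K}
    {F : IntermediateField k K} (hF : ∀ x ∈ F, D x = 0) {x : K} (hx : IsAlgebraic F x) :
    D x = 0 := by
  let D' : Derivation F K K := Derivation.mk'
    { toFun := D
      map_add' := map_add D
      map_smul' := fun a b => by simp [IntermediateField.smul_def, hF _ a.2] }
    fun a b => D.leibniz a b
  have h : Polynomial.aeval x (minpoly F x).derivative • D' x = 0 := by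
    rw [← Derivation.map_aeval, minpoly.aeval, map_zero]
  exact (smul_eq_zero.mp h).resolve_left
    ((minpoly.irreducible hx.isIntegral).separable.aeval_derivative_ne_zero (minpoly.aeval F x))

theorem derivation_eq_zero_of_isTranscendenceBasis [CharZero k] {ι : Type*} {x : ι → K}
    (hx : IsTranscendenceBasis k x) {D : Derivation k K K} (hD : ∀ i, D (x i) = 0) : D = 0 := by
  ext z
  have : Algebra.IsAlgebraic (IntermediateField.adjoin k (Set.range x)) K := hx.isAlgebraic_field
  exact derivation_eq_zero_of_isAlgebraic
    (fun _ => derivation_eq_zero_of_mem_adjoin (Set.forall_mem_range.mpr hD))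
    (Algebra.IsAlgebraic.isAlgebraic z)

theorem exists_eq_smul_of_algebraicIndependent [CharZero k] {ι : Type*} [Fintype ι] {x : ι → K}
    (hx : AlgebraicIndependent k x) (htr : Algebra.trdeg k K ≤ Fintype.card ι + 1)
    {D E : Derivation k K K} (hD : ∀ i, D (x i) = 0) (hE : ∀ i, E (x i) = 0) (hE0 : E ≠ 0) :
    ∃ f : K, D = f • E := by
  obtain ⟨t, ht⟩ : ∃ t, E t ≠ 0 := by
    by_contra! h
    exact hE0 (Derivation.ext h)
  have htrans : Transcendental (Algebra.adjoin k (Set.range x)) t := fun halg =>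
    ht (derivation_eq_zero_of_isAlgebraic
      (fun _ => derivation_eq_zero_of_mem_adjoin (Set.forall_mem_range.mpr hE))
      (IntermediateField.isAlgebraic_adjoin_iff.mpr halg))
  have hind : AlgebraicIndependent k fun o : Option ι => o.elim t x :=
    (hx.option_iff_transcendental t).mpr htrans
  have hbasis := hind.isTranscendenceBasis_of_lift_trdeg_le_of_finite
    (by simpa using Cardinal.lift_le.mpr htr)
  have hzero : E t • D - D t • E = 0 :=
    derivation_eq_zero_of_isTranscendenceBasis hbasis fun o => by
      cases o <;> simp [hD, hE, mul_comm]
  refine ⟨D t / E t, Derivation.ext fun z => ?_⟩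
  have hz : E t * D z - D t * E z = 0 := DFunLike.congr_fun hzero z
  rw [Derivation.smul_apply, smul_eq_mul]
  field_simp
  linear_combination hz

end Derivation

section Degree

variable {σ R : Type*} [CommRing R]

theorem degreeOf_le_degreeOf_of_dvd [NoZeroDivisors R] {f g : MvPolynomial σ R} (hfg : f ∣ g)
    (hg : g ≠ 0) (k : σ) : degreeOf k f ≤ degreeOf k g := by
  obtain ⟨q, rfl⟩ := hfg
  rw [degreeOf_mul_eq (left_ne_zero_of_mul hg) (right_ne_zero_of_mul hg)]
  exact Nat.le_add_right _ _

theorem degreeOf_pderiv_lt {f : MvPolynomial σ R} {k : σ} (hk : 0 < degreeOf k f) :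
    degreeOf k (pderiv k f) < degreeOf k f := by
  rw [degreeOf_lt_iff hk]
  intro s hs
  rw [mem_support_iff, coeff_pderiv] at hs
  have hle := monomial_le_degreeOf k (mem_support_iff.mpr (left_ne_zero_of_mul hs))
  rw [Finsupp.add_apply, Finsupp.single_eq_same] at hle
  exact hle

theorem pderiv_ne_zero [NoZeroDivisors R] [CharZero R] {f : MvPolynomial σ R} {k : σ}
    (hk : k ∈ f.vars) : pderiv k f ≠ 0 := by
  obtain ⟨s, hs, hsk⟩ := (mem_vars_iff_mem_support k).mp hk
  have hle : Finsupp.single k 1 ≤ s := by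
    rw [Finsupp.single_le_iff]
    exact Nat.one_le_iff_ne_zero.mpr (Finsupp.mem_support_iff.mp hsk)
  intro h0
  have hcoeff := congrArg (coeff (s - Finsupp.single k 1)) h0
  rw [coeff_pderiv, coeff_zero, tsub_add_cancel_of_le hle] at hcoeff
  exact (mul_ne_zero (mem_support_iff.mp hs) (Nat.cast_add_one_ne_zero _)) hcoeff

theorem exists_mem_vars_of_irreducible {k : Type*} [Field k] {f : MvPolynomial σ k}
    (hf : Irreducible f) : ∃ i, i ∈ f.vars := by
  by_contra! h
  have hC := vars_eq_empty_iff_eq_C.mp (Finset.eq_empty_of_forall_notMem h)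
  have hc : coeff 0 f ≠ 0 := fun h0 => hf.ne_zero (by rw [hC, h0, map_zero])
  exact hf.not_isUnit (hC ▸ (isUnit_iff_ne_zero.mpr hc).map C)

theorem not_dvd_pderiv [NoZeroDivisors R] [CharZero R] {f : MvPolynomial σ R} {k : σ}
    (hk : k ∈ f.vars) : ¬ f ∣ pderiv k f := fun h =>
  (degreeOf_pderiv_lt (Nat.pos_of_ne_zero (mem_vars_iff_degreeOf_ne_zero.mp hk))).not_ge
    (degreeOf_le_degreeOf_of_dvd h (pderiv_ne_zero hk) k)

end Degree

section Parametrization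

/-- The linear form `l_i` evaluated at a vector over an arbitrary ring; for instance
`lin C i X` is `l_i` as a polynomial. -/
def lin {R : Type*} [Ring R] (C : Matrix (Fin n) (Fin m) ℤ) (i : Fin n) (v : Fin m → R) : R :=
  ∑ k, (C i k : R) * v k

/-- The parametrization `ψ_C` evaluated at a vector over an arbitrary field; over the field of
rational functions it is also evaluated at the generic point. -/
noncomputable def psiAt {K : Type*} [Field K] (C : Matrix (Fin n) (Fin m) ℤ) (v : Fin m → K) :
    Fin m → K :=
  fun k => ∏ i, lin C i v ^ C i k

variable {C : Matrix (Fin n) (Fin m) ℤ} {K : Type*} [Field K]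

theorem map_lin {R S : Type*} [Ring R] [Ring S] (φ : R →+* S) (C : Matrix (Fin n) (Fin m) ℤ)
    (i : Fin n) (v : Fin m → R) : φ (lin C i v) = lin C i fun k => φ (v k) := by
  simp [lin]

theorem aeval_lin_X {R A : Type*} [CommRing R] [CommRing A] [Algebra R A]
    (C : Matrix (Fin n) (Fin m) ℤ) (i : Fin n) (v : Fin m → A) :
    aeval v (lin C i (X : Fin m → MvPolynomial (Fin m) R)) = lin C i v := by
  simp [lin]

theorem lin_X_ne_zero {R : Type*} [CommRing R] [CharZero R] {i : Fin n} (h : C i ≠ 0) :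
    lin C i (X : Fin m → MvPolynomial (Fin m) R) ≠ 0 := by
  obtain ⟨k, hk⟩ := Function.ne_iff.mp h
  intro h0
  have heval := aeval_lin_X (R := R) C i (Pi.single k (1 : R))
  rw [h0, map_zero] at heval
  exact hk (by simpa [lin, Pi.single_apply] using heval.symm)

theorem lin_smul {R : Type*} [CommRing R] (C : Matrix (Fin n) (Fin m) ℤ) (i : Fin n) (c : R)
    (v : Fin m → R) : lin C i (c • v) = c * lin C i v := by
  simp only [lin, Pi.smul_apply, smul_eq_mul, Finset.mul_sum]
  exact Finset.sum_congr rfl fun k _ => by ring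

theorem map_psiAt {L : Type*} [Field L] (φ : K →+* L) (C : Matrix (Fin n) (Fin m) ℤ)
    (v : Fin m → K) (k : Fin m) : φ (psiAt C v k) = psiAt C (fun k => φ (v k)) k := by
  simp only [psiAt, map_prod, map_zpow₀, map_lin]

theorem psiAt_ne_zero {v : Fin m → K} (hv : ∀ i, lin C i v ≠ 0) (k : Fin m) :
    psiAt C v k ≠ 0 :=
  Finset.prod_ne_zero_iff.mpr fun i _ => zpow_ne_zero _ (hv i)

theorem prod_zpow_eq_zpow_sum {ι G : Type*} [CommGroup G] (c : G) (s : Finset ι) (e : ι → ℤ) :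
    ∏ i ∈ s, c ^ e i = c ^ ∑ i ∈ s, e i :=
  (map_sum (zmultiplesHom (Additive G) (.ofMul c)) e s).symm

theorem prod_zpow_eq_zpow_sum₀ {ι G : Type*} [CommGroupWithZero G] {c : G} (hc : c ≠ 0)
    (s : Finset ι) (e : ι → ℤ) : ∏ i ∈ s, c ^ e i = c ^ ∑ i ∈ s, e i := by
  lift c to Gˣ using hc.isUnit
  exact_mod_cast congrArg Units.val (prod_zpow_eq_zpow_sum c s e)

theorem psiAt_smul (hreg : IsRegular C) {c : K} (hc : c ≠ 0) (v : Fin m → K) :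
    psiAt C (c • v) = psiAt C v := by
  funext k
  simp only [psiAt, lin_smul, mul_zpow, Finset.prod_mul_distrib, prod_zpow_eq_zpow_sum₀ hc, hreg k,
    zpow_zero, one_mul]

theorem derivation_psiAt {R : Type*} [CommRing R] [Algebra R K] (D : Derivation R K K)
    {v : Fin m → K} (hv : ∀ i, lin C i v ≠ 0) (k : Fin m) :
    D (psiAt C v k) =
      psiAt C v k * ∑ i, C i k * (lin C i (fun j => D (v j)) / lin C i v) := by
  have hlin (i : Fin n) : D (lin C i v) = lin C i fun j => D (v j) := by
    simp [lin, Derivation.leibniz]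
  simp only [← hlin]
  exact derivation_prod_zpow D _ _ fun i _ => hv i

theorem derivation_psiAt_eq_zero {R : Type*} [CommRing R] [Algebra R K] (hreg : IsRegular C)
    {D : Derivation R K K} {v : Fin m → K} (hD : ∀ k, D (v k) = v k)
    (hv : ∀ i, lin C i v ≠ 0) (k : Fin m) : D (psiAt C v k) = 0 := by
  have hcol : ∑ i, (C i k : K) = 0 := by exact_mod_cast congrArg (Int.cast : ℤ → K) (hreg k)
  simp only [derivation_psiAt D hv, hD, div_self (hv _), mul_one, hcol, mul_zero]

end Parametrization

section Equation

variable {C : Matrix (Fin n) (Fin m) ℤ} {Δ f : MvPolynomial (Fin m) ℂ}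

/-- The function field `ℂ(u_1, …, u_m)` of the source of `ψ_C`. -/
abbrev FunField (m : ℕ) : Type := FractionRing (MvPolynomial (Fin m) ℂ)

/-- The generic point `(u_1, …, u_m)` of the source of `ψ_C`. -/
noncomputable def coord (k : Fin m) : FunField m :=
  algebraMap (MvPolynomial (Fin m) ℂ) (FunField m) (X k)

/-- The comorphism `f ↦ f ∘ ψ_C` from `ℂ[y]` to `ℂ(u)`. -/
noncomputable def pullback (C : Matrix (Fin n) (Fin m) ℤ) :
    MvPolynomial (Fin m) ℂ →ₐ[ℂ] FunField m :=
  aeval (psiAt C coord)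

theorem aeval_coord (f : MvPolynomial (Fin m) ℂ) :
    aeval coord f = algebraMap _ (FunField m) f :=
  (aeval_algebraMap_apply (FunField m) X f).trans (by rw [aeval_X_left_apply])

theorem exists_derivation_coord (g : Fin m → FunField m) :
    ∃ D : Derivation ℂ (FunField m) (FunField m), ∀ k, D (coord k) = g k :=
  exists_derivation_fractionRing g

theorem coord_ne_zero (k : Fin m) : coord k ≠ 0 := by
  simp [coord]

theorem lin_coord_ne_zero {i : Fin n} (h : C i ≠ 0) : lin C i (coord (m := m)) ≠ 0 := by
  rw [← aeval_lin_X (R := ℂ), aeval_coord]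
  simpa using lin_X_ne_zero h

theorem prod_lin_ne_zero {R : Type*} [CommRing R] [IsDomain R] {v : Fin m → R}
    (hv : ∀ i, lin C i v ≠ 0) (N : ℕ) : (∏ i, lin C i v) ^ N ≠ 0 :=
  pow_ne_zero _ (Finset.prod_ne_zero_iff.mpr fun i _ => hv i)

/-- Clearing the denominators of `f ∘ ψ_C`, uniformly in the point of evaluation. -/
theorem exists_numerator (C : Matrix (Fin n) (Fin m) ℤ) (f : MvPolynomial (Fin m) ℂ) :
    ∃ (N : ℕ) (F : MvPolynomial (Fin m) ℂ), ∀ (K : Type) [Field K] [Algebra ℂ K] (v : Fin m → K),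
      (∀ i, lin C i v ≠ 0) → aeval v F = aeval (psiAt C v) f * (∏ i, lin C i v) ^ N := by
  induction f using MvPolynomial.induction_on with
  | C a => exact ⟨0, MvPolynomial.C a, by simp⟩
  | add p q hp hq =>
    obtain ⟨N, F, hF⟩ := hp
    obtain ⟨N', F', hF'⟩ := hq
    refine ⟨N + N', F * (∏ i, lin C i X) ^ N' + F' * (∏ i, lin C i X) ^ N, fun K _ _ v hv => ?_⟩
    simp only [map_add, map_mul, map_pow, map_prod, aeval_lin_X, hF K v hv, hF' K v hv]
    ring
  | mul_X p k hp =>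
    obtain ⟨N, F, hF⟩ := hp
    obtain ⟨N', hN'⟩ : ∃ N' : ℕ, ∀ i, (C i k).natAbs ≤ N' :=
      ⟨∑ i, (C i k).natAbs, fun i =>
        Finset.single_le_sum (f := fun i => (C i k).natAbs) (by simp) (Finset.mem_univ i)⟩
    refine ⟨N + N', F * ∏ i, lin C i X ^ (C i k + N').toNat, fun K _ _ v hv => ?_⟩
    have hprod : ∏ i, lin C i v ^ (C i k + N').toNat = psiAt C v k * (∏ i, lin C i v) ^ N' := by
      rw [psiAt, ← Finset.prod_pow, ← Finset.prod_mul_distrib]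
      refine Finset.prod_congr rfl fun i _ => ?_
      have hnonneg : 0 ≤ C i k + N' := by have := hN' i; lia
      rw [← zpow_natCast, ← zpow_natCast, Int.toNat_of_nonneg hnonneg, zpow_add₀ (hv i)]
    simp only [map_mul, map_pow, map_prod, aeval_lin_X, hF K v hv, aeval_X, hprod]
    ring

theorem pullback_eq_zero_iff (hrow : ∀ i, C i ≠ 0) {s : Set (Fin m → ℂ)}
    (hs : vanishingIdeal ℂ s = ⊥) :
    pullback C f = 0 ↔ ∀ u ∈ s, (∀ i, lin C i u ≠ 0) → aeval (psiAt C u) f = 0 := by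
  have hcoord (i : Fin n) : lin C i (coord (m := m)) ≠ 0 := lin_coord_ne_zero (hrow i)
  obtain ⟨N, F, hF⟩ := exists_numerator C f
  have hgeneric := hF (FunField m) coord hcoord
  rw [aeval_coord] at hgeneric
  constructor
  · intro h u _ hu
    have hF0 : F = 0 := by
      rw [show aeval (psiAt C coord) f = 0 from h, zero_mul] at hgeneric
      simpa using hgeneric
    have hFu := hF ℂ u hu
    rw [hF0, map_zero] at hFu
    exact (mul_eq_zero.mp hFu.symm).resolve_right (prod_lin_ne_zero hu N)
  · intro h
    have hmul : F * ∏ i, lin C i X = 0 := by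
      rw [← Ideal.mem_bot, ← hs]
      intro u hus
      rw [map_mul, map_prod]
      simp only [aeval_lin_X]
      by_cases hu : ∀ i, lin C i u ≠ 0
      · rw [hF ℂ u hu, h u hus hu, zero_mul, zero_mul]
      · push Not at hu
        obtain ⟨i, hi⟩ := hu
        rw [Finset.prod_eq_zero (Finset.mem_univ i) hi, mul_zero]
    have hF0 : F = 0 := (mul_eq_zero.mp hmul).resolve_right
      (Finset.prod_ne_zero_iff.mpr fun i _ => lin_X_ne_zero (hrow i))
    rw [hF0, map_zero] at hgeneric
    exact (mul_eq_zero.mp hgeneric.symm).resolve_right (prod_lin_ne_zero hcoord N)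

theorem vanishingIdeal_univ : vanishingIdeal ℂ (Set.univ : Set (Fin m → ℂ)) = ⊥ :=
  le_bot_iff.mp fun _ hF => MvPolynomial.funext fun u => by
    simpa [aeval_eq_eval] using hF u (Set.mem_univ u)

theorem mem_vanishingIdeal_psiImage_iff :
    f ∈ vanishingIdeal ℂ (psiImage C) ↔
      ∀ u : Fin m → ℂ, (∀ i, lin C i u ≠ 0) → aeval (psiAt C u) f = 0 :=
  Set.forall_mem_image

theorem mem_vanishingIdeal_psiImage_iff_pullback (hrow : ∀ i, C i ≠ 0) :
    f ∈ vanishingIdeal ℂ (psiImage C) ↔ pullback C f = 0 := by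
  simp only [mem_vanishingIdeal_psiImage_iff, pullback_eq_zero_iff hrow vanishingIdeal_univ,
    Set.mem_univ, true_imp_iff]

theorem vanishingIdeal_S (C : Matrix (Fin n) (Fin m) ℤ) :
    vanishingIdeal ℂ (S C) = vanishingIdeal ℂ (psiImage C) :=
  le_antisymm (fun _ hf y hy => hf y fun _ hp => hp y hy) fun _ hf _ hy => hy _ hf

/-- `Δ` is an equation of the hypersurface `S_C` over `ℂ`: it is irreducible and generates the
ideal of the image of `ψ_C`. In contrast to `IsDiscriminant` it is determined up to a complex
constant only. -/
structure IsEquation (C : Matrix (Fin n) (Fin m) ℤ) (Δ : MvPolynomial (Fin m) ℂ) : Prop where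
  irreducible : Irreducible Δ
  vanishingIdeal_eq : vanishingIdeal ℂ (psiImage C) = Ideal.span {Δ}

theorem IsDiscriminant.isEquation {Δ : MvPolynomial (Fin m) ℤ} (h : IsDiscriminant C Δ) :
    IsEquation C (toComplex Δ) := by
  obtain ⟨hirr, hzero, -⟩ := h
  have : (Ideal.span {toComplex Δ}).IsPrime :=
    (Ideal.span_singleton_prime hirr.ne_zero).mpr hirr.prime
  have hS : S C = zeroLocus ℂ (Ideal.span {toComplex Δ}) := by
    rw [← hzero, zeroLocus_span]
    simp [aeval_eq_eval]
  exact ⟨hirr, by rw [← vanishingIdeal_S, hS, IsPrime.vanishingIdeal_zeroLocus]⟩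

theorem NonDefective.exists_isEquation (hrow : ∀ i, C i ≠ 0) (h : NonDefective C) :
    ∃ Δ, IsEquation C Δ := by
  rw [NonDefective, vanishingIdeal_S] at h
  have hker : vanishingIdeal ℂ (psiImage C) = RingHom.ker (pullback C) :=
    Ideal.ext fun _ => mem_vanishingIdeal_psiImage_iff_pullback hrow
  have hprime : (vanishingIdeal ℂ (psiImage C)).IsPrime := hker ▸ RingHom.ker_isPrime _
  obtain ⟨Δ, hΔ, hΔprime⟩ := hprime.exists_mem_prime_of_ne_bot (Ideal.ne_bot_of_height_eq_one h)
  exact ⟨Δ, hΔprime.irreducible, Ideal.eq_span_singleton_of_height_eq_one h hΔ hΔprime⟩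

namespace IsEquation

theorem dvd_iff (h : IsEquation C Δ) :
    Δ ∣ f ↔ ∀ u : Fin m → ℂ, (∀ i, lin C i u ≠ 0) → aeval (psiAt C u) f = 0 := by
  rw [← Ideal.mem_span_singleton, ← h.vanishingIdeal_eq, mem_vanishingIdeal_psiImage_iff]

theorem dvd_iff_pullback (h : IsEquation C Δ) (hrow : ∀ i, C i ≠ 0) :
    Δ ∣ f ↔ pullback C f = 0 := by
  rw [← Ideal.mem_span_singleton, ← h.vanishingIdeal_eq,
    mem_vanishingIdeal_psiImage_iff_pullback hrow]

theorem not_dvd_X (h : IsEquation C Δ) (hrow : ∀ i, C i ≠ 0) (k : Fin m) : ¬ Δ ∣ X k := by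
  rw [h.dvd_iff_pullback hrow, pullback, aeval_X]
  exact psiAt_ne_zero (fun i => lin_coord_ne_zero (hrow i)) k

theorem algebraicIndependent (h : IsEquation C Δ) (hrow : ∀ i, C i ≠ 0) {k₀ : Fin m}
    (hk₀ : k₀ ∈ Δ.vars) :
    AlgebraicIndependent ℂ fun k : {k // k ≠ k₀} => psiAt C (coord (m := m)) k := by
  rw [algebraicIndependent_iff]
  intro p hp
  by_contra hp0
  let p' := rename (Subtype.val : {k // k ≠ k₀} → Fin m) p
  have hp' : p' ≠ 0 := (map_ne_zero_iff _ (rename_injective _ Subtype.val_injective)).mpr hp0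
  have hdvd : Δ ∣ p' := by
    rw [h.dvd_iff_pullback hrow, pullback, aeval_rename]
    exact hp
  have hdeg : degreeOf k₀ p' = 0 := by
    by_contra hne
    obtain ⟨k, -, hk⟩ := mem_vars_rename _ p (mem_vars_iff_degreeOf_ne_zero.mpr hne)
    exact k.2 hk
  exact mem_vars_iff_degreeOf_ne_zero.mp hk₀
    (Nat.le_zero.mp (hdeg ▸ degreeOf_le_degreeOf_of_dvd hdvd hp' k₀))

end IsEquation

theorem trdeg_funField : Algebra.trdeg ℂ (FunField m) = m := by
  have : Algebra.IsAlgebraic (MvPolynomial (Fin m) ℂ) (FunField m) :=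
    IsLocalization.isAlgebraic _ (nonZeroDivisors _)
  simpa using (IsTranscendenceBasis.mvPolynomial (Fin m) ℂ).algebraMap_comp (A := FunField m)
    |>.lift_cardinalMk_eq_trdeg.symm

/-- The fibres of `ψ_C` are one-dimensional, and the Euler vector field is tangent to them. -/
theorem IsEquation.exists_derivation_coord_eq_smul (h : IsEquation C Δ) (hrow : ∀ i, C i ≠ 0)
    (hreg : IsRegular C) {D : Derivation ℂ (FunField m) (FunField m)}
    (hD : ∀ k, D (psiAt C coord k) = 0) : ∃ f : FunField m, ∀ k, D (coord k) = f * coord k := by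
  obtain ⟨k₀, hk₀⟩ := exists_mem_vars_of_irreducible h.irreducible
  obtain ⟨E, hE⟩ := exists_derivation_coord (coord (m := m))
  have hE0 : E ≠ 0 := by
    rintro rfl
    exact coord_ne_zero k₀ (hE k₀).symm
  have hcard : Algebra.trdeg ℂ (FunField m) ≤ Fintype.card {k // k ≠ k₀} + 1 := by
    rw [trdeg_funField, Fintype.card_subtype_compl]
    have := k₀.pos
    simp
    norm_cast
    lia
  obtain ⟨f, rfl⟩ := exists_eq_smul_of_algebraicIndependent
    (h.algebraicIndependent hrow hk₀) hcard (fun k => hD k)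
    (fun k => derivation_psiAt_eq_zero hreg hE (fun i => lin_coord_ne_zero (hrow i)) k) hE0
  exact ⟨f, fun k => congrArg (f * ·) (hE k)⟩

theorem IsEquation.mulVec_injective [NeZero n] (h : IsEquation C Δ) (hrow : ∀ i, C i ≠ 0)
    (hreg : IsRegular C) : Function.Injective C.mulVec := by
  rw [← Matrix.coe_mulVecLin, ← LinearMap.ker_eq_bot, LinearMap.ker_eq_bot']
  intro v hv
  have hlin (i : Fin n) : lin C i (fun k => (v k : FunField m)) = 0 := by
    have hvi := congrArg (Int.cast : ℤ → FunField m) (congrFun hv i)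
    simpa [Matrix.mulVec, dotProduct, lin] using hvi
  obtain ⟨D, hD⟩ := exists_derivation_coord fun k => (v k : FunField m)
  obtain ⟨f, hf⟩ := h.exists_derivation_coord_eq_smul hrow hreg (D := D) fun k => by
    simp [derivation_psiAt D fun i => lin_coord_ne_zero (hrow i), hD, hlin]
  have hv_eq : (fun k => (v k : FunField m)) = f • coord := funext fun k => hD k ▸ hf k
  have hf0 : f = 0 := by
    have h0 := hlin 0
    rw [hv_eq, lin_smul] at h0
    exact (mul_eq_zero.mp h0).resolve_right (lin_coord_ne_zero (hrow 0))
  funext k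
  simpa [hf0] using congrFun hv_eq k

end Equation

section Scale

/-- The logarithmic derivative `y_k ∂/∂y_k`. -/
noncomputable def theta (k : Fin m) :
    Derivation ℂ (MvPolynomial (Fin m) ℂ) (MvPolynomial (Fin m) ℂ) :=
  (X k : MvPolynomial (Fin m) ℂ) • pderiv k

theorem theta_apply (k : Fin m) (f : MvPolynomial (Fin m) ℂ) : theta k f = X k * pderiv k f :=
  rfl

theorem theta_monomial (k : Fin m) (s : Fin m →₀ ℕ) (a : ℂ) :
    theta k (monomial s a) = (s k : ℂ) • monomial s a := by
  rw [theta_apply, X_mul_pderiv_monomial, Nat.cast_smul_eq_nsmul]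

theorem scale_monomial (ε : Fin m → ℂˣ) (s : Fin m →₀ ℕ) (a : ℂ) :
    scale ε (monomial s a) = (((∏ k, ε k ^ s k : ℂˣ) : ℂ)) • monomial s a := by
  rw [scale, aeval_monomial, Finsupp.prod_fintype _ _ (by simp), smul_monomial, smul_eq_mul,
    mul_comm, monomial_eq, Finsupp.prod_fintype _ _ (by simp)]
  simp only [mul_pow, Finset.prod_mul_distrib, Units.coe_prod, Units.val_pow_eq_pow_val, map_mul,
    map_prod, map_pow, algebraMap_eq]
  ring

theorem coeff_scale (ε : Fin m → ℂˣ) (f : MvPolynomial (Fin m) ℂ) (s : Fin m →₀ ℕ) :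
    coeff s (scale ε f) = ((∏ k, ε k ^ s k : ℂˣ) : ℂ) * coeff s f := by
  induction f using MvPolynomial.induction_on' with
  | monomial t a =>
    obtain rfl | h := eq_or_ne t s
    · simp [scale_monomial]
    · simp [scale_monomial, h]
  | add p q hp hq => rw [map_add, coeff_add, coeff_add, hp, hq, mul_add]

theorem scale_X (ε : Fin m → ℂˣ) (k : Fin m) : scale ε (X k) = (ε k : ℂ) • X k := by
  rw [scale, aeval_X, smul_eq_C_mul]

theorem scale_scale (ε ε' : Fin m → ℂˣ) (f : MvPolynomial (Fin m) ℂ) :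
    scale ε (scale ε' f) = scale (ε * ε') f := by
  ext s
  simp only [coeff_scale, Pi.mul_apply, mul_pow, Finset.prod_mul_distrib, Units.val_mul, mul_assoc]

theorem scale_one (f : MvPolynomial (Fin m) ℂ) : scale 1 f = f := by
  ext s
  simp [coeff_scale]

theorem scale_theta (ε : Fin m → ℂˣ) (k : Fin m) (f : MvPolynomial (Fin m) ℂ) :
    scale ε (theta k f) = theta k (scale ε f) := by
  induction f using MvPolynomial.induction_on' with
  | monomial s a =>
    rw [theta_monomial, map_smul, scale_monomial, Derivation.map_smul, theta_monomial, smul_comm]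
  | add p q hp hq => simp only [map_add, hp, hq]

/-- `f ↦ f(ε · y)` as an automorphism of the polynomial ring. -/
noncomputable def scaleEquiv (ε : Fin m → ℂˣ) :
    MvPolynomial (Fin m) ℂ ≃ₐ[ℂ] MvPolynomial (Fin m) ℂ :=
  AlgEquiv.ofAlgHom (scale ε) (scale ε⁻¹)
    (AlgHom.ext fun f => by simp [scale_scale, scale_one])
    (AlgHom.ext fun f => by simp [scale_scale, scale_one])

theorem scale_dvd_scale_iff (ε : Fin m → ℂˣ) {f g : MvPolynomial (Fin m) ℂ} :
    scale ε f ∣ scale ε g ↔ f ∣ g :=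
  map_dvd_iff (scaleEquiv ε)

theorem scale_irreducible {f : MvPolynomial (Fin m) ℂ} (hf : Irreducible f) (ε : Fin m → ℂˣ) :
    Irreducible (scale ε f) :=
  (MulEquiv.irreducible_iff (scaleEquiv ε)).mpr hf

theorem scale_dvd_X_iff (ε : Fin m → ℂˣ) {f : MvPolynomial (Fin m) ℂ} {k : Fin m} :
    scale ε f ∣ X k ↔ f ∣ X k := by
  rw [← scale_dvd_scale_iff ε (f := f), scale_X, smul_eq_C_mul]
  exact (((ε k).isUnit.map C).dvd_mul_left).symm

end Scale

section GaussMap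

variable {C : Matrix (Fin n) (Fin m) ℤ} {Δ : MvPolynomial (Fin m) ℂ}

theorem psiAt_map_eq_iff_of_ker_eq {R A K : Type*} [CommRing R] [CommRing A] [Field K]
    [Algebra R A] [Algebra R K] (C : Matrix (Fin n) (Fin m) ℤ) {φ φ' : A →ₐ[R] K}
    (hker : RingHom.ker φ = RingHom.ker φ') (g : Fin m → A) (k : Fin m) (x : A) :
    psiAt C (fun j => φ (g j)) k = φ x ↔ psiAt C (fun j => φ' (g j)) k = φ' x := by
  have hP : (RingHom.ker φ).IsPrime := RingHom.ker_isPrime φ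
  have key (χ : A →ₐ[R] K) (hχ : RingHom.ker χ = RingHom.ker φ) :
      psiAt C (fun j => χ (g j)) k = χ x ↔
        psiAt C (fun j => algebraMap A (RingHom.ker φ).ResidueField (g j)) k =
          algebraMap A (RingHom.ker φ).ResidueField x := by
    let ι : (RingHom.ker φ).ResidueField →+* K :=
      Ideal.ResidueField.lift (RingHom.ker φ) χ.toRingHom hχ.ge fun a ha => by
        rw [Submonoid.mem_comap, IsUnit.mem_submonoid_iff, isUnit_iff_ne_zero]
        exact fun h0 => ha (hχ.le h0)
    have hι (a : A) : χ a = ι (algebraMap A _ a) := (Ideal.ResidueField.lift_algebraMap ..).symm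
    simp only [hι, ← map_psiAt, ι.injective.eq_iff]
  rw [key φ rfl, key φ' hker.symm]

namespace IsEquation

theorem pullback_theta (k : Fin m) :
    pullback C (theta k Δ) = psiAt C coord k * pullback C (pderiv k Δ) := by
  rw [theta_apply, map_mul, pullback, aeval_X]

/-- The matrix `(∂ log ψ_k / ∂u_a)` is symmetric, so the relation `∂(Δ ∘ ψ_C) / ∂u_a = 0` also
says that the vector field `∑ θ_k(Δ) ∂/∂u_k` kills `log ψ_a`. -/
theorem sum_lin_theta_eq_zero (h : IsEquation C Δ) (hrow : ∀ i, C i ≠ 0) (a : Fin m) :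
    ∑ i, (C i a : FunField m) *
      (lin C i (fun k => pullback C (theta k Δ)) / lin C i coord) = 0 := by
  obtain ⟨E, hE⟩ := exists_derivation_coord (Pi.single a (1 : FunField m))
  have hlin (i : Fin n) : lin C i (Pi.single a (1 : FunField m)) = C i a := by
    simp [lin, Pi.single_apply]
  have hΔ : aeval (psiAt C coord) Δ = (0 : FunField m) := (h.dvd_iff_pullback hrow).mp dvd_rfl
  have hchain := derivation_aeval E (psiAt C coord) Δ
  rw [hΔ, map_zero] at hchain
  rw [hchain]
  simp only [derivation_psiAt _ fun i => lin_coord_ne_zero (hrow i), hE, hlin, pullback_theta]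
  simp only [lin, Finset.sum_div, Finset.mul_sum]
  rw [Finset.sum_comm]
  refine Finset.sum_congr rfl fun k _ => Finset.sum_congr rfl fun i _ => ?_
  rw [pullback]
  ring

theorem exists_pullback_theta_eq_smul (h : IsEquation C Δ) (hrow : ∀ i, C i ≠ 0)
    (hreg : IsRegular C) :
    ∃ b : FunField m, b ≠ 0 ∧ (fun k => pullback C (theta k Δ)) = b • coord := by
  obtain ⟨D, hD⟩ := exists_derivation_coord fun k => pullback C (theta k Δ)
  obtain ⟨b, hb⟩ := h.exists_derivation_coord_eq_smul hrow hreg (D := D) fun k => by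
    simp only [derivation_psiAt D fun i => lin_coord_ne_zero (hrow i), hD,
      h.sum_lin_theta_eq_zero hrow, mul_zero]
  refine ⟨b, ?_, funext fun k => by rw [← hD, hb, Pi.smul_apply, smul_eq_mul]⟩
  rintro rfl
  obtain ⟨k, hk⟩ := exists_mem_vars_of_irreducible h.irreducible
  refine not_dvd_pderiv hk ((h.dvd_iff_pullback hrow).mpr ?_)
  have hθ := hb k
  rw [hD, zero_mul, pullback_theta] at hθ
  exact (mul_eq_zero.mp hθ).resolve_left (psiAt_ne_zero (fun i => lin_coord_ne_zero (hrow i)) k)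

/-- `ψ_C` is inverse to the logarithmic Gauss map of the hypersurface `Δ = 0`. -/
theorem psiAt_pullback_theta (h : IsEquation C Δ) (hrow : ∀ i, C i ≠ 0) (hreg : IsRegular C) :
    psiAt C (fun k => pullback C (theta k Δ)) = psiAt C coord := by
  obtain ⟨b, hb, hθ⟩ := h.exists_pullback_theta_eq_smul hrow hreg
  rw [hθ, psiAt_smul hreg hb]

theorem ker_pullback_comp_scale (h : IsEquation C Δ) (hrow : ∀ i, C i ≠ 0) {ε : Fin m → ℂˣ}
    (hε : Associated Δ (scale ε Δ)) :
    RingHom.ker ((pullback C).comp (scale ε)) = RingHom.ker (pullback C) := by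
  ext f
  rw [RingHom.mem_ker, RingHom.mem_ker, AlgHom.comp_apply, ← h.dvd_iff_pullback hrow,
    ← h.dvd_iff_pullback hrow, hε.dvd_iff_dvd_left, scale_dvd_scale_iff]

theorem eq_one_of_associated_scale (h : IsEquation C Δ) (hrow : ∀ i, C i ≠ 0)
    (hreg : IsRegular C) {ε : Fin m → ℂˣ} (hε : Associated Δ (scale ε Δ)) : ε = 1 := by
  obtain ⟨c, hc, hscale⟩ : ∃ c : ℂ, c ≠ 0 ∧ scale ε Δ = c • Δ := by
    obtain ⟨u, hu⟩ := hε
    obtain ⟨c, hc, hcu⟩ := isUnit_iff_eq_C_of_isReduced.mp u.isUnit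
    exact ⟨c, hc.ne_zero, by rw [← hu, hcu, mul_comm, smul_eq_C_mul]⟩
  funext k
  have hgauss : psiAt C (fun j => pullback C (theta j Δ)) k = pullback C (X k) := by
    rw [h.psiAt_pullback_theta hrow hreg, pullback, aeval_X]
  have htransfer := (psiAt_map_eq_iff_of_ker_eq C (h.ker_pullback_comp_scale hrow hε)
    (theta · Δ) k (X k)).mpr hgauss
  have hsmul : (fun j => (pullback C).comp (scale ε) (theta j Δ)) =
      algebraMap ℂ (FunField m) c • fun j => pullback C (theta j Δ) := by
    funext j
    rw [AlgHom.comp_apply, scale_theta, hscale, Derivation.map_smul, map_smul, Pi.smul_apply,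
      algebraMap_smul]
  rw [hsmul, psiAt_smul hreg (by simpa using hc), hgauss, AlgHom.comp_apply, scale_X, map_smul,
    Algebra.smul_def, pullback, aeval_X] at htransfer
  have hεk : algebraMap ℂ (FunField m) (ε k) = 1 :=
    (mul_eq_right₀ (psiAt_ne_zero (fun i => lin_coord_ne_zero (hrow i)) k)).mp htransfer.symm
  exact Units.ext ((algebraMap ℂ (FunField m)).injective (hεk.trans (map_one _).symm))

theorem prime_scale (h : IsEquation C Δ) (ε : Fin m → ℂˣ) : Prime (scale ε Δ) :=
  (scale_irreducible h.irreducible ε).prime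

theorem not_scale_dvd_X (h : IsEquation C Δ) (hrow : ∀ i, C i ≠ 0) (ε : Fin m → ℂˣ) (k : Fin m) :
    ¬ scale ε Δ ∣ X k :=
  mt (scale_dvd_X_iff ε).mp (h.not_dvd_X hrow k)

theorem isRelPrime_scale (h : IsEquation C Δ) (hrow : ∀ i, C i ≠ 0) (hreg : IsRegular C)
    {ε ε' : Fin m → ℂˣ} (hne : ε ≠ ε') : IsRelPrime (scale ε Δ) (scale ε' Δ) := by
  rw [(scale_irreducible h.irreducible ε).isRelPrime_iff_not_dvd]
  intro hdvd
  have hdvd' : Δ ∣ scale (ε⁻¹ * ε') Δ := by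
    rwa [← scale_dvd_scale_iff ε, scale_scale, mul_inv_cancel_left]
  refine hne (inv_mul_eq_one.mp (h.eq_one_of_associated_scale hrow hreg ?_))
  exact (h.irreducible.dvd_irreducible_iff_associated (scale_irreducible h.irreducible _)).mp hdvd'

end IsEquation

end GaussMap

section Lattice

variable {M : Matrix (Fin m) (Fin m) ℤ} {A : Type*} [CommGroup A]

/-- The character `w ↦ y^w` of `ℤ^m` given by a tuple of elements of a commutative group. -/
def monomialHom (y : Fin m → A) : Multiplicative (Fin m → ℤ) →* A where
  toFun w := ∏ i, y i ^ w.toAdd i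
  map_one' := by simp
  map_mul' v w := by simp [zpow_add, Finset.prod_mul_distrib]

theorem monomialHom_ofAdd (y : Fin m → A) (w : Fin m → ℤ) :
    monomialHom y (.ofAdd w) = ∏ i, y i ^ w i :=
  rfl

theorem monomialHom_single (y : Fin m → A) (k : Fin m) (a : ℤ) :
    monomialHom y (.ofAdd (Pi.single k a)) = y k ^ a := by
  rw [monomialHom_ofAdd, Finset.prod_eq_single k (fun i _ hi => by simp [hi]) (by simp),
    Pi.single_eq_same]

theorem monomialHom_apply_single (φ : Multiplicative (Fin m → ℤ) →* A) :
    monomialHom (fun i => φ (.ofAdd (Pi.single i 1))) = φ := by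
  ext k
  exact (monomialHom_single _ k 1).trans (zpow_one _)

theorem monomialHom_mulVec (M : Matrix (Fin m) (Fin m) ℤ) (y : Fin m → A) (x : Fin m → ℤ) :
    monomialHom y (.ofAdd (M.mulVec x)) =
      monomialHom (fun k => monomialHom y (.ofAdd (M.col k))) (.ofAdd x) := by
  simp only [monomialHom_ofAdd, Matrix.mulVec, dotProduct, ← Finset.prod_zpow, ← zpow_mul,
    Matrix.col_apply]
  rw [Finset.prod_comm]
  exact Finset.prod_congr rfl fun i _ => (prod_zpow_eq_zpow_sum ..).symm

theorem mem_columnLattice_iff {w : Fin m → ℤ} : w ∈ columnLattice M ↔ ∃ x, M.mulVec x = w := by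
  rw [columnLattice, ← Matrix.range_mulVecLin]
  rfl

theorem mem_G_iff {ε : Fin m → ℂˣ} : ε ∈ G M ↔ ∀ k, monomialHom ε (.ofAdd (M.col k)) = 1 :=
  funext_iff

theorem monomialHom_mulVec_eq_one {ε : Fin m → ℂˣ} (hε : ε ∈ G M) (x : Fin m → ℤ) :
    monomialHom ε (.ofAdd (M.mulVec x)) = 1 := by
  rw [monomialHom_mulVec, funext (mem_G_iff.mp hε)]
  simp [monomialHom_ofAdd]

theorem finite_quotient_columnLattice (hM : Function.Injective M.mulVec) :
    Finite ((Fin m → ℤ) ⧸ columnLattice M) := by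
  refine Submodule.finiteQuotientOfFreeOfRankEq _ ?_
  rw [columnLattice, ← Matrix.range_mulVecLin, LinearMap.finrank_range_of_inj hM]

theorem finite_G (hM : Function.Injective M.mulVec) : Finite (G M) := by
  have := finite_quotient_columnLattice hM
  let N := Nat.card ((Fin m → ℤ) ⧸ columnLattice M)
  have : NeZero N := ⟨Nat.card_pos.ne'⟩
  have hroot : ∀ ε ∈ G M, ∀ i, ε i ^ N = 1 := by
    intro ε hε i
    have hmem : (N • Pi.single i 1 : Fin m → ℤ) ∈ columnLattice M := by
      rw [← Submodule.Quotient.mk_eq_zero, Submodule.Quotient.mk_smul]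
      exact card_nsmul_eq_zero'
    obtain ⟨x, hx⟩ := mem_columnLattice_iff.mp hmem
    have hone := monomialHom_mulVec_eq_one hε x
    rwa [hx, ofAdd_nsmul, map_pow, monomialHom_single, zpow_one] at hone
  have hfin : (rootsOfUnity N ℂ : Set ℂˣ).Finite :=
    inferInstanceAs (Finite (rootsOfUnity N ℂ))
  exact ((Set.Finite.pi fun _ => hfin).subset fun ε hε i _ => hroot ε hε i).to_subtype

theorem exists_mem_G_monomialHom_ne_one (hM : Function.Injective M.mulVec) {w : Fin m → ℤ}
    (hw : w ∉ columnLattice M) : ∃ ε ∈ G M, monomialHom ε (.ofAdd w) ≠ 1 := by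
  have := finite_quotient_columnLattice hM
  let π : Multiplicative (Fin m → ℤ) →* Multiplicative ((Fin m → ℤ) ⧸ columnLattice M) :=
    (columnLattice M).mkQ.toAddMonoidHom.toMultiplicative
  have hπ (v : Fin m → ℤ) : π (.ofAdd v) = 1 ↔ v ∈ columnLattice M :=
    Submodule.Quotient.mk_eq_zero _
  have : NeZero (Monoid.exponent (Multiplicative ((Fin m → ℤ) ⧸ columnLattice M))) :=
    ⟨Monoid.exponent_ne_zero_of_finite⟩
  obtain ⟨χ, hχ⟩ :=
    CommGroup.exists_apply_ne_one_of_hasEnoughRootsOfUnity _ ℂ (mt (hπ w).mp hw)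
  refine ⟨fun i => χ (π (.ofAdd (Pi.single i 1))), mem_G_iff.mpr fun k => ?_, ?_⟩
  · have hcol : M.col k ∈ columnLattice M := Submodule.subset_span ⟨k, rfl⟩
    have hχk := DFunLike.congr_fun (monomialHom_apply_single (χ.comp π)) (.ofAdd (M.col k))
    rwa [MonoidHom.comp_apply, (hπ _).mpr hcol, map_one] at hχk
  · exact fun h => hχ ((DFunLike.congr_fun (monomialHom_apply_single (χ.comp π)) _).symm.trans h)

theorem mem_columnLattice_iff_forall_mem_G (hM : Function.Injective M.mulVec) {w : Fin m → ℤ} :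
    w ∈ columnLattice M ↔ ∀ ε ∈ G M, monomialHom ε (.ofAdd w) = 1 := by
  constructor
  · rw [mem_columnLattice_iff]
    rintro ⟨x, rfl⟩ ε hε
    exact monomialHom_mulVec_eq_one hε x
  · contrapose!
    exact exists_mem_G_monomialHom_ne_one hM

end Lattice

section Laurent

variable {M : Matrix (Fin m) (Fin m) ℤ} {q F : MvPolynomial (Fin m) ℂ}

/-- The exponent of a monomial of `ℂ[y]`, seen as an exponent of the Laurent polynomial ring. -/
def castExp : (Fin m →₀ ℕ) →+ (Fin m → ℤ) where
  toFun s i := s i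
  map_zero' := by funext i; simp
  map_add' s t := by funext i; simp

theorem castExp_apply (s : Fin m →₀ ℕ) (i : Fin m) : castExp s i = s i :=
  rfl

theorem castExp_injective : Function.Injective (castExp (m := m)) := fun _ _ h =>
  Finsupp.ext fun i => Nat.cast_injective (congrFun h i)

theorem castExp_eq_sum (s : Fin m →₀ ℕ) : castExp s = ∑ i, s i • Pi.single i 1 := by
  funext j
  simp [castExp_apply, Finset.sum_apply, Pi.single_apply]

theorem mono_add (v w : Fin m → ℤ) : mono (v + w) = mono v * mono w := by
  rw [mono, mono, mono, AddMonoidAlgebra.single_mul_single, one_mul]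

theorem toLaurent_monomial (s : Fin m →₀ ℕ) (a : ℂ) :
    toLaurent (monomial s a) = AddMonoidAlgebra.single (castExp s) a := by
  rw [toLaurent, aeval_monomial, Finsupp.prod_fintype _ _ fun i => pow_zero _]
  simp only [mono, AddMonoidAlgebra.single_pow, AddMonoidAlgebra.prod_single, one_pow,
    Finset.prod_const_one, ← castExp_eq_sum]
  rw [← Algebra.smul_def, AddMonoidAlgebra.smul_single, smul_eq_mul, mul_one]

theorem toLaurent_monomial_one (s : Fin m →₀ ℕ) : toLaurent (monomial s 1) = mono (castExp s) :=
  toLaurent_monomial s 1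

theorem coeff_toLaurent (f : MvPolynomial (Fin m) ℂ) (s : Fin m →₀ ℕ) :
    (toLaurent f).coeff (castExp s) = f.coeff s := by
  induction f using MvPolynomial.induction_on' with
  | monomial t a =>
    obtain rfl | h := eq_or_ne t s
    · simp [toLaurent_monomial]
    · simp [toLaurent_monomial, h, castExp_injective.ne h.symm]
  | add p q hp hq => simp [hp, hq]

theorem toLaurent_injective : Function.Injective (toLaurent (m := m)) := fun f g h => by
  ext s
  rw [← coeff_toLaurent, ← coeff_toLaurent, h]

theorem isUnit_single (v : Fin m → ℤ) {c : ℂ} (hc : c ≠ 0) :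
    IsUnit (AddMonoidAlgebra.single v c : Laurent m) :=
  .of_mul_eq_one (AddMonoidAlgebra.single (-v) c⁻¹) <| by
    rw [AddMonoidAlgebra.single_mul_single, add_neg_cancel, mul_inv_cancel₀ hc,
      AddMonoidAlgebra.one_def]

theorem isUnit_mono (v : Fin m → ℤ) : IsUnit (mono v) :=
  isUnit_single v one_ne_zero

theorem exists_mono_mul_eq_toLaurent (h : Laurent m) :
    ∃ s f, mono (castExp s) * h = toLaurent f := by
  induction h using AddMonoidAlgebra.induction_linear with
  | zero => exact ⟨0, 0, by simp⟩
  | add p q hp hq =>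
    obtain ⟨s, f, hf⟩ := hp
    obtain ⟨t, g, hg⟩ := hq
    refine ⟨s + t, monomial t 1 * f + monomial s 1 * g, ?_⟩
    simp only [map_add, map_mul, ← hf, ← hg, toLaurent_monomial_one, mono_add]
    ring
  | single w a =>
    refine ⟨Finsupp.equivFunOnFinite.symm fun i => (-w i).toNat,
      monomial (Finsupp.equivFunOnFinite.symm fun i => (w i).toNat) a, ?_⟩
    rw [toLaurent_monomial, mono, AddMonoidAlgebra.single_mul_single, one_mul]
    congr 1
    funext i
    simp only [castExp_apply, Pi.add_apply, Finsupp.equivFunOnFinite_symm_apply_apply]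
    omega

theorem exists_eq_single_of_isUnit {h : Laurent m} (hh : IsUnit h) :
    ∃ v c, c ≠ 0 ∧ h = AddMonoidAlgebra.single v c := by
  obtain ⟨h', hh'⟩ := hh.exists_right_inv
  obtain ⟨s, f, hf⟩ := exists_mono_mul_eq_toLaurent h
  obtain ⟨t, g, hg⟩ := exists_mono_mul_eq_toLaurent h'
  have hfg : f * g = monomial (s + t) 1 := by
    apply toLaurent_injective
    rw [map_mul, ← hf, ← hg, toLaurent_monomial_one, map_add, mono_add]
    linear_combination (mono (castExp s) * mono (castExp t)) * hh'
  obtain ⟨r, b, -, hb, rfl⟩ := (dvd_monomial_iff_exists one_ne_zero).mp (Dvd.intro g hfg)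
  refine ⟨castExp r - castExp s, b, ?_, (isUnit_mono (castExp s)).mul_left_cancel ?_⟩
  · rintro rfl
    exact one_ne_zero (zero_dvd_iff.mp hb)
  · rw [hf, toLaurent_monomial, mono, AddMonoidAlgebra.single_mul_single, one_mul, add_sub_cancel]

theorem toLaurent_dvd_toLaurent_iff (hq : Prime q) (hX : ∀ k, ¬ q ∣ X k) :
    toLaurent q ∣ toLaurent F ↔ q ∣ F := by
  refine ⟨?_, map_dvd _⟩
  rintro ⟨h, hh⟩
  obtain ⟨s, f, hf⟩ := exists_mono_mul_eq_toLaurent h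
  have hdvd : q ∣ monomial s 1 * F := ⟨f, toLaurent_injective <| by
    rw [map_mul, map_mul, hh, ← hf, toLaurent_monomial_one]
    ring⟩
  refine (hq.dvd_or_dvd hdvd).resolve_left fun hs => ?_
  rw [monomial_eq, map_one, one_mul, Finsupp.prod, hq.dvd_finsetProd_iff] at hs
  obtain ⟨k, -, hk⟩ := hs
  exact hX k (hq.dvd_of_dvd_pow hk)

theorem toLaurent_prod_dvd {ι : Type*} [Fintype ι] {p : ι → MvPolynomial (Fin m) ℂ}
    (hp : ∀ i, Prime (p i)) (hX : ∀ i k, ¬ p i ∣ X k)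
    (hrel : Pairwise fun i j => IsRelPrime (p i) (p j)) {h : Laurent m}
    (hh : ∀ i, toLaurent (p i) ∣ h) : toLaurent (∏ i, p i) ∣ h := by
  obtain ⟨s, f, hf⟩ := exists_mono_mul_eq_toLaurent h
  simp only [← (isUnit_mono (castExp s)).dvd_mul_left (b := h), hf] at hh ⊢
  exact map_dvd _ (Fintype.prod_dvd_of_isRelPrime hrel fun i =>
    (toLaurent_dvd_toLaurent_iff (hp i) (hX i)).mp (hh i))

theorem emultiplicity_toLaurent_mul_eq_one (hq : Prime q) (hX : ∀ k, ¬ q ∣ X k) (hF : ¬ q ∣ F) :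
    emultiplicity (toLaurent q) (toLaurent (q * F)) = 1 := by
  have hq0 : toLaurent q ≠ 0 := (map_ne_zero_iff _ toLaurent_injective).mpr hq.ne_zero
  refine emultiplicity_eq_of_dvd_of_not_dvd (k := 1) ?_ ?_
  · rw [pow_one, map_mul]
    exact dvd_mul_right _ _
  · rwa [pow_succ, pow_one, map_mul, mul_dvd_mul_iff_left hq0,
      toLaurent_dvd_toLaurent_iff hq hX]

/-- The substitution `y ↦ α_M(y)` in Laurent polynomials, extending `compAlpha`. -/
noncomputable def monoMap (M : Matrix (Fin m) (Fin m) ℤ) : Laurent m →ₐ[ℂ] Laurent m :=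
  AddMonoidAlgebra.mapDomainAlgHom ℂ ℂ M.mulVecLin.toAddMonoidHom

theorem monoMap_single (M : Matrix (Fin m) (Fin m) ℤ) (w : Fin m → ℤ) (a : ℂ) :
    monoMap M (AddMonoidAlgebra.single w a) = AddMonoidAlgebra.single (M.mulVec w) a := by
  simp [monoMap]

theorem monoMap_toLaurent (M : Matrix (Fin m) (Fin m) ℤ) (f : MvPolynomial (Fin m) ℂ) :
    monoMap M (toLaurent f) = compAlpha M f := by
  refine DFunLike.congr_fun (f := (monoMap M).comp toLaurent)
    (MvPolynomial.algHom_ext fun k => ?_) f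
  rw [AlgHom.comp_apply, toLaurent, compAlpha, aeval_X, aeval_X, mono, mono, monoMap_single,
    Matrix.mulVec_single_one]

theorem coeff_monoMap_of_notMem (h : Laurent m) {w : Fin m → ℤ} (hw : w ∉ columnLattice M) :
    (monoMap M h).coeff w = 0 := by
  induction h using AddMonoidAlgebra.induction_linear with
  | zero => simp
  | add p q hp hq => simp [hp, hq]
  | single v a =>
    have hne : w ≠ M.mulVec v := fun h => hw (mem_columnLattice_iff.mpr ⟨v, h.symm⟩)
    simp [monoMap_single, hne]

theorem exists_monoMap_eq_toLaurent (hF : ∀ s ∈ F.support, castExp s ∈ columnLattice M) :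
    ∃ g, monoMap M g = toLaurent F := by
  suffices toLaurent F ∈ (monoMap M).range from this
  rw [F.as_sum, map_sum]
  refine sum_mem fun s hs => ?_
  obtain ⟨x, hx⟩ := mem_columnLattice_iff.mp (hF s hs)
  exact ⟨AddMonoidAlgebra.single x (coeff s F), by
    rw [toLaurent_monomial, ← hx]; exact monoMap_single M x _⟩

/-- Evaluation of Laurent polynomials at a point of the torus. -/
noncomputable def evalLaurent (y : Fin m → ℂˣ) : Laurent m →ₐ[ℂ] ℂ :=
  AddMonoidAlgebra.lift ℂ ℂ (Fin m → ℤ) ((Units.coeHom ℂ).comp (monomialHom y))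

theorem evalLaurent_mono (y : Fin m → ℂˣ) (w : Fin m → ℤ) :
    evalLaurent y (mono w) = monomialHom y (.ofAdd w) := by
  rw [evalLaurent, mono, AddMonoidAlgebra.lift_single, one_smul]
  rfl

theorem evalLaurent_toLaurent (y : Fin m → ℂˣ) (f : MvPolynomial (Fin m) ℂ) :
    evalLaurent y (toLaurent f) = aeval (fun k => (y k : ℂ)) f := by
  refine DFunLike.congr_fun (f := (evalLaurent y).comp toLaurent)
    (MvPolynomial.algHom_ext fun k => ?_) f
  rw [AlgHom.comp_apply, toLaurent, aeval_X, aeval_X, evalLaurent_mono, monomialHom_single,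
    zpow_one]

theorem evalLaurent_monoMap (M : Matrix (Fin m) (Fin m) ℤ) (y : Fin m → ℂˣ) (h : Laurent m) :
    evalLaurent y (monoMap M h) = evalLaurent (alpha M y) h := by
  refine DFunLike.congr_fun (f := (evalLaurent y).comp (monoMap M))
    (AddMonoidAlgebra.algHom_ext (fun w => ?_) (Subsingleton.elim _ _)) h
  rw [AlgHom.comp_apply, monoMap_single, ← mono, ← mono, evalLaurent_mono, evalLaurent_mono,
    monomialHom_mulVec]
  rfl

end Laurent

section Factorization

variable {C : Matrix (Fin n) (Fin m) ℤ} {M : Matrix (Fin m) (Fin m) ℤ}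
  {Δ Δ₁ Δ₂ : MvPolynomial (Fin m) ℂ}

/-- The point `ψ_C(u)` of the torus, for `u` outside the hyperplanes `l_i = 0`. -/
noncomputable def psiUnits {u : Fin m → ℂ} (hu : ∀ i, lin C i u ≠ 0) : Fin m → ℂˣ :=
  fun k => Units.mk0 (psiAt C u k) (psiAt_ne_zero hu k)

theorem aeval_scale (ε : Fin m → ℂˣ) (y : Fin m → ℂ) (f : MvPolynomial (Fin m) ℂ) :
    aeval y (scale ε f) = aeval (fun k => ε k * y k) f := by
  rw [scale, comp_aeval_apply]
  simp

theorem IsEquation.toLaurent_scale_dvd_iff (h : IsEquation C Δ) (ε : Fin m → ℂˣ) {g : Laurent m} :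
    toLaurent (scale ε Δ) ∣ g ↔
      ∀ (u : Fin m → ℂ) (hu : ∀ i, lin C i u ≠ 0), evalLaurent (ε⁻¹ * psiUnits hu) g = 0 := by
  have hpoint {u : Fin m → ℂ} (hu : ∀ i, lin C i u ≠ 0) (f : MvPolynomial (Fin m) ℂ) :
      evalLaurent (ε⁻¹ * psiUnits hu) (toLaurent f) = aeval (psiAt C u) (scale ε⁻¹ f) := by
    rw [evalLaurent_toLaurent, aeval_scale]
    rfl
  obtain ⟨s, f, hf⟩ := exists_mono_mul_eq_toLaurent g
  constructor
  · rintro ⟨g, rfl⟩ u hu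
    rw [map_mul, hpoint hu, scale_scale, inv_mul_cancel, scale_one, h.dvd_iff.mp dvd_rfl u hu,
      zero_mul]
  · intro hg
    rw [← (isUnit_mono (castExp s)).dvd_mul_left, hf]
    refine map_dvd _ ?_
    rw [← scale_dvd_scale_iff ε⁻¹, scale_scale, inv_mul_cancel, scale_one, h.dvd_iff]
    intro u hu
    rw [← hpoint hu, ← hf, map_mul, hg, mul_zero]

theorem lin_mul (C : Matrix (Fin n) (Fin m) ℤ) (M : Matrix (Fin m) (Fin m) ℤ) (i : Fin n)
    (u : Fin m → ℂ) : lin (C * M) i u = lin C i ((M.map (Int.castRingHom ℂ)).mulVec u) := by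
  have hassoc := Matrix.mulVec_mulVec u (C.map (Int.castRingHom ℂ)) (M.map (Int.castRingHom ℂ))
  rw [← Matrix.map_mul] at hassoc
  exact congrFun hassoc.symm i

theorem psiUnits_mul {u : Fin m → ℂ} (hu : ∀ i, lin (C * M) i u ≠ 0)
    (hMu : ∀ i, lin C i ((M.map (Int.castRingHom ℂ)).mulVec u) ≠ 0) :
    psiUnits hu = alpha M (psiUnits hMu) := by
  funext k
  refine Units.ext ?_
  simp only [psiUnits, psiAt, alpha, MonoidHom.coe_mk, OneHom.coe_mk, Units.val_mk0,
    Units.coe_prod, Units.val_zpow_eq_zpow_val, ← Finset.prod_zpow, ← zpow_mul]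
  rw [Finset.prod_comm]
  refine Finset.prod_congr rfl fun i _ => ?_
  rw [prod_zpow_eq_zpow_sum₀ (hMu i), lin_mul, Matrix.mul_apply]

theorem surjective_mulVec_map_intCast (hM : Function.Injective M.mulVec) :
    Function.Surjective (M.map (Int.castRingHom ℂ)).mulVec := by
  rw [Matrix.mulVec_surjective_iff_isUnit, Matrix.isUnit_iff_isUnit_det, isUnit_iff_ne_zero,
    ← RingHom.mapMatrix_apply, ← RingHom.map_det, map_ne_zero_iff _ (RingHom.injective_int _)]
  intro hdet
  obtain ⟨x, hx, hMx⟩ := Matrix.exists_mulVec_eq_zero_iff.mpr hdet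
  exact hx (hM (hMx.trans (Matrix.mulVec_zero M).symm))

theorem toLaurent_scale_dvd_monoMap_iff (h₁ : IsEquation (C * M) Δ₁) (h₂ : IsEquation C Δ₂)
    (hM : Function.Injective M.mulVec) {ε : Fin m → ℂˣ} (hε : ε ∈ G M) {g : Laurent m} :
    toLaurent (scale ε Δ₂) ∣ monoMap M g ↔ toLaurent Δ₁ ∣ g := by
  have hone := h₁.toLaurent_scale_dvd_iff 1 (g := g)
  rw [scale_one] at hone
  rw [h₂.toLaurent_scale_dvd_iff, hone]
  simp only [evalLaurent_monoMap, map_mul, (G M).inv_mem hε |> MonoidHom.mem_ker.mp, inv_one,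
    one_mul]
  constructor
  · intro h u hu
    have hMu := hu
    simp only [lin_mul] at hMu
    rw [psiUnits_mul hu hMu]
    exact h _ hMu
  · intro h v hv
    obtain ⟨u, rfl⟩ := surjective_mulVec_map_intCast hM v
    have hu := hv
    simp only [← lin_mul] at hu
    rw [← psiUnits_mul hu hv]
    exact h u hu

/-- The product of the polynomials `Δ(ε · y)`, `ε ∈ G_M`. -/
noncomputable def scaleProd (M : Matrix (Fin m) (Fin m) ℤ) [Fintype (G M)]
    (Δ : MvPolynomial (Fin m) ℂ) : MvPolynomial (Fin m) ℂ :=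
  ∏ ε : G M, scale ε Δ

section ScaleProd

variable [Fintype (G M)]

theorem scale_scaleProd {ε : Fin m → ℂˣ} (hε : ε ∈ G M) (Δ : MvPolynomial (Fin m) ℂ) :
    scale ε (scaleProd M Δ) = scaleProd M Δ := by
  simp only [scaleProd, map_prod, scale_scale]
  exact Fintype.prod_equiv (Equiv.mulLeft (⟨ε, hε⟩ : G M)) _ _ fun _ => rfl

theorem castExp_mem_columnLattice_of_mem_support (hM : Function.Injective M.mulVec)
    {s : Fin m →₀ ℕ} (hs : s ∈ (scaleProd M Δ).support) : castExp s ∈ columnLattice M := by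
  rw [mem_columnLattice_iff_forall_mem_G hM]
  intro ε hε
  have hcoeff := coeff_scale ε (scaleProd M Δ) s
  rw [scale_scaleProd hε] at hcoeff
  have hone := (mul_eq_right₀ (mem_support_iff.mp hs)).mp hcoeff.symm
  simpa [monomialHom_ofAdd, castExp_apply] using Units.ext hone

theorem toLaurent_scaleProd_dvd_compAlpha (h₁ : IsEquation (C * M) Δ₁) (h₂ : IsEquation C Δ₂)
    (hrow : ∀ i, C i ≠ 0) (hreg : IsRegular C) (hM : Function.Injective M.mulVec) :
    toLaurent (scaleProd M Δ₂) ∣ compAlpha M Δ₁ := by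
  have hp (ε : G M) : Prime (scale ε Δ₂) := h₂.prime_scale ε
  have hX (ε : G M) : ∀ k, ¬ scale ε Δ₂ ∣ X k := h₂.not_scale_dvd_X hrow ε
  have hrel : Pairwise fun ε ε' : G M => IsRelPrime (scale ε Δ₂) (scale ε' Δ₂) :=
    fun _ _ hne => h₂.isRelPrime_scale hrow hreg (Subtype.coe_injective.ne hne)
  have hdvd (ε : G M) : toLaurent (scale ε Δ₂) ∣ compAlpha M Δ₁ := by
    rw [← monoMap_toLaurent, toLaurent_scale_dvd_monoMap_iff h₁ h₂ hM ε.2]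
  exact toLaurent_prod_dvd hp hX hrel hdvd

theorem compAlpha_dvd_toLaurent_scaleProd (h₁ : IsEquation (C * M) Δ₁) (h₂ : IsEquation C Δ₂)
    (hM : Function.Injective M.mulVec) : compAlpha M Δ₁ ∣ toLaurent (scaleProd M Δ₂) := by
  obtain ⟨g, hg⟩ := exists_monoMap_eq_toLaurent (F := scaleProd M Δ₂) fun _ =>
    castExp_mem_columnLattice_of_mem_support hM
  have hdvd := Finset.dvd_prod_of_mem (fun ε : G M => scale ε Δ₂) (Finset.mem_univ 1)
  rw [← scaleProd, OneMemClass.coe_one] at hdvd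
  rw [← hg, ← monoMap_toLaurent]
  refine map_dvd _ ((toLaurent_scale_dvd_monoMap_iff h₁ h₂ hM (one_mem _)).mp ?_)
  rw [hg]
  exact map_dvd _ hdvd

theorem mem_columnLattice_of_compAlpha_eq (hM : Function.Injective M.mulVec) {v : Fin m → ℤ}
    {c : ℂ} (hc : c ≠ 0) (hΔ₂ : scaleProd M Δ₂ ≠ 0)
    (h : compAlpha M Δ₁ = AddMonoidAlgebra.single v c * toLaurent (scaleProd M Δ₂)) :
    v ∈ columnLattice M := by
  obtain ⟨s, hs⟩ := support_nonempty.mpr hΔ₂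
  rw [← Submodule.add_mem_iff_left _ (castExp_mem_columnLattice_of_mem_support hM hs)]
  by_contra hv
  have hcoeff := coeff_monoMap_of_notMem (toLaurent Δ₁) hv
  rw [monoMap_toLaurent, h, AddMonoidAlgebra.coeff_single_mul_add, coeff_toLaurent] at hcoeff
  exact mul_ne_zero hc (mem_support_iff.mp hs) hcoeff

theorem exists_compAlpha_eq (h₁ : IsEquation (C * M) Δ₁) (h₂ : IsEquation C Δ₂)
    (hrow : ∀ i, C i ≠ 0) (hreg : IsRegular C) (hM : Function.Injective M.mulVec) :
    ∃ v ∈ columnLattice M, ∃ c ≠ 0,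
      compAlpha M Δ₁ = AddMonoidAlgebra.single v c * toLaurent (scaleProd M Δ₂) := by
  obtain ⟨u, hu⟩ := associated_of_dvd_dvd
    (toLaurent_scaleProd_dvd_compAlpha h₁ h₂ hrow hreg hM)
    (compAlpha_dvd_toLaurent_scaleProd h₁ h₂ hM)
  obtain ⟨v, c, hc, huv⟩ := exists_eq_single_of_isUnit u.isUnit
  rw [huv, mul_comm] at hu
  have hprod : scaleProd M Δ₂ ≠ 0 :=
    Finset.prod_ne_zero_iff.mpr fun ε _ => (scale_irreducible h₂.irreducible ε).ne_zero
  exact ⟨v, mem_columnLattice_of_compAlpha_eq hM hc hprod hu.symm, c, hc, hu.symm⟩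

end ScaleProd

theorem emultiplicity_compAlpha_eq_one (h₁ : IsEquation (C * M) Δ₁) (h₂ : IsEquation C Δ₂)
    (hrow : ∀ i, C i ≠ 0) (hreg : IsRegular C) (hM : Function.Injective M.mulVec)
    {ε : Fin m → ℂˣ} (hε : ε ∈ G M) :
    emultiplicity (toLaurent (scale ε Δ₂)) (compAlpha M Δ₁) = 1 := by
  classical
  have := finite_G hM
  cases nonempty_fintype (G M)
  obtain ⟨ε, rfl⟩ : ∃ ε' : G M, ε' = ε := ⟨⟨ε, hε⟩, rfl⟩
  rw [← emultiplicity_eq_of_associated_right (associated_of_dvd_dvd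
    (toLaurent_scaleProd_dvd_compAlpha h₁ h₂ hrow hreg hM)
    (compAlpha_dvd_toLaurent_scaleProd h₁ h₂ hM)), scaleProd,
    ← Finset.mul_prod_erase _ _ (Finset.mem_univ ε)]
  refine emultiplicity_toLaurent_mul_eq_one (h₂.prime_scale ε) (h₂.not_scale_dvd_X hrow ε) ?_
  rw [(h₂.prime_scale ε).dvd_finsetProd_iff]
  rintro ⟨ε', hε', hdvd⟩
  have hne : (ε : Fin m → ℂˣ) ≠ ε' := Subtype.coe_injective.ne (Finset.ne_of_mem_erase hε').symm
  exact (h₂.prime_scale ε).irreducible.isRelPrime_iff_not_dvd.mp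
    (h₂.isRelPrime_scale hrow hreg hne) hdvd

end Factorization

section Content

variable {σ : Type*} (T : Type*) {A : Type*} [CommRing T] [CommRing A] [Algebra T A]

/-- The `T`-submodule of `A` spanned by the coefficients of a polynomial over `A`. For `T = A` it is
the content ideal; in general, `coeffSpan T f = 1` means that `f` is the image of a polynomial over
`T` whose coefficients generate the unit ideal. -/
def coeffSpan (f : MvPolynomial σ A) : Submodule T A :=
  Submodule.span T (Set.range fun s => f.coeff s)

theorem coeff_mem_coeffSpan (f : MvPolynomial σ A) (s : σ →₀ ℕ) : f.coeff s ∈ coeffSpan T f :=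
  Submodule.subset_span ⟨s, rfl⟩

variable {T}

theorem coeffSpan_le_iff {f : MvPolynomial σ A} {N : Submodule T A} :
    coeffSpan T f ≤ N ↔ ∀ s, f.coeff s ∈ N := by
  rw [coeffSpan, Submodule.span_le, Set.range_subset_iff]
  rfl

theorem coeffSpan_map_algebraMap (f : MvPolynomial σ T) :
    coeffSpan T (map (algebraMap T A) f) = (coeffSpan T f).map (Algebra.linearMap T A) := by
  rw [coeffSpan, coeffSpan, Submodule.map_span, ← Set.range_comp]
  simp only [coeff_map]
  rfl

theorem coeffSpan_eq_top_iff {f : MvPolynomial σ T} :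
    coeffSpan T f = ⊤ ↔
      ∀ I : Ideal T, I.IsMaximal → map (Ideal.Quotient.mk I) f ≠ 0 := by
  have hle (I : Ideal T) : coeffSpan T f ≤ I ↔ map (Ideal.Quotient.mk I) f = 0 := by
    simp only [coeffSpan_le_iff, MvPolynomial.ext_iff, coeff_map, coeff_zero,
      Ideal.Quotient.eq_zero_iff_mem]
  constructor
  · intro hf I hI hmap
    exact hI.ne_top (top_le_iff.mp (hf ▸ (hle I).mpr hmap))
  · intro hf
    by_contra hne
    obtain ⟨I, hI, hfI⟩ := Ideal.exists_le_maximal _ hne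
    exact hf I hI ((hle I).mp hfI)

theorem coeffSpan_prod_eq_top {ι : Type*} (t : Finset ι) {f : ι → MvPolynomial σ T}
    (hf : ∀ i ∈ t, coeffSpan T (f i) = ⊤) : coeffSpan T (∏ i ∈ t, f i) = ⊤ := by
  simp only [coeffSpan_eq_top_iff] at *
  intro I hI
  rw [map_prod, Finset.prod_ne_zero_iff]
  exact fun i hi => hf i hi I hI

theorem coeffSpan_eq_one_iff [FaithfulSMul T A] {f : MvPolynomial σ A} :
    coeffSpan T f = 1 ↔ ∃ g : MvPolynomial σ T, map (algebraMap T A) g = f ∧ coeffSpan T g = ⊤ := by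
  have hmap : (⊤ : Submodule T T).map (Algebra.linearMap T A) = 1 := by
    rw [Submodule.map_top, Submodule.one_eq_range]
  constructor
  · intro hf
    obtain ⟨g, rfl⟩ : ∃ g, map (algebraMap T A) g = f := by
      refine mem_range_map_iff_coeffs_subset.mpr fun a ha => ?_
      obtain ⟨s, -, rfl⟩ := mem_coeffs_iff.mp ha
      exact Submodule.mem_one.mp (hf ▸ coeff_mem_coeffSpan T f s)
    refine ⟨g, rfl, Submodule.map_injective_of_injective (f := Algebra.linearMap T A)
      (FaithfulSMul.algebraMap_injective T A) ?_⟩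
    rw [← coeffSpan_map_algebraMap, hf, hmap]
  · rintro ⟨g, rfl, hg⟩
    rw [coeffSpan_map_algebraMap, hg, hmap]

theorem coeffSpan_prod_eq_one [FaithfulSMul T A] {ι : Type*} (t : Finset ι)
    {f : ι → MvPolynomial σ A} (hf : ∀ i, coeffSpan T (f i) = 1) :
    coeffSpan T (∏ i ∈ t, f i) = 1 := by
  simp only [coeffSpan_eq_one_iff] at *
  choose g hg hg_top using hf
  exact ⟨∏ i ∈ t, g i, by simp only [map_prod, hg], coeffSpan_prod_eq_top t fun i _ => hg_top i⟩

theorem coeffSpan_map_intCast_eq_one {D : MvPolynomial σ ℤ}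
    (hD : (D.support.gcd fun s => D.coeff s) = 1) :
    coeffSpan T (map (Int.castRingHom A) D) = 1 := by
  refine le_antisymm (coeffSpan_le_iff.mpr fun s => ?_) (Submodule.one_le.mpr ?_)
  · rw [coeff_map]
    exact Submodule.mem_one.mpr ⟨(D.coeff s : ℤ), map_intCast _ _⟩
  · obtain ⟨z, hz⟩ := Finset.gcd_eq_sum_mul D.support fun s => D.coeff s
    rw [hD] at hz
    have hone := congrArg (Int.cast (R := A)) hz
    push_cast at hone
    rw [hone]
    refine sum_mem fun s _ => ?_
    have hs := (coeffSpan T _).smul_mem (z s : T)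
      (coeff_mem_coeffSpan T (map (Int.castRingHom A) D) s)
    rwa [Algebra.smul_def, map_intCast, coeff_map, eq_intCast, mul_comm] at hs

end Content

section Constant

variable {M : Matrix (Fin m) (Fin m) ℤ} {Δ₁ Δ₂ : MvPolynomial (Fin m) ℂ}

theorem coeffSpan_scale (T : Subalgebra ℤ ℂ) {ε : Fin m → ℂˣ} (hε : ∀ k, (ε k : ℂ) ∈ T)
    (hε' : ∀ k, (↑(ε k)⁻¹ : ℂ) ∈ T) (f : MvPolynomial (Fin m) ℂ) :
    coeffSpan T (scale ε f) = coeffSpan T f := by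
  have hle {ε : Fin m → ℂˣ} (hε : ∀ k, (ε k : ℂ) ∈ T) (f : MvPolynomial (Fin m) ℂ) :
      coeffSpan T (scale ε f) ≤ coeffSpan T f := by
    refine coeffSpan_le_iff.mpr fun s => ?_
    have hprod : ((∏ k, ε k ^ s k : ℂˣ) : ℂ) ∈ T := by
      push_cast
      exact prod_mem fun k _ => pow_mem (hε k) _
    rw [coeff_scale]
    exact (coeffSpan T f).smul_mem ⟨_, hprod⟩ (coeff_mem_coeffSpan T f s)
  refine le_antisymm (hle hε f) ?_
  have hinv := hle (ε := ε⁻¹) hε' (scale ε f)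
  rwa [scale_scale, inv_mul_cancel, scale_one] at hinv

theorem isIntegral_of_isOfFinOrder {ζ : ℂˣ} (hζ : IsOfFinOrder ζ) : IsIntegral ℤ (ζ : ℂ) := by
  refine IsIntegral.of_pow hζ.orderOf_pos ?_
  rw [← Units.val_pow_eq_pow_val, pow_orderOf_eq_one]
  exact isIntegral_one

theorem coeffSpan_scaleProd_eq_one [Fintype (G M)] {D : MvPolynomial (Fin m) ℤ}
    (hD : (D.support.gcd fun s => D.coeff s) = 1) :
    coeffSpan (integralClosure ℤ ℂ) (scaleProd M (toComplex D)) = 1 := by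
  refine coeffSpan_prod_eq_one _ fun ε => ?_
  have hint (ε : G M) (k : Fin m) : ((ε : Fin m → ℂˣ) k : ℂ) ∈ integralClosure ℤ ℂ :=
    isIntegral_of_isOfFinOrder (((G M).subtype.isOfFinOrder (isOfFinOrder_of_finite ε)).apply k)
  rw [coeffSpan_scale _ (hint ε) (hint ε⁻¹)]
  exact coeffSpan_map_intCast_eq_one hD

theorem coeff_compAlpha_mem_coeffSpan (T : Type*) [CommRing T] [Algebra T ℂ]
    (M : Matrix (Fin m) (Fin m) ℤ) (f : MvPolynomial (Fin m) ℂ) (w : Fin m → ℤ) :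
    (compAlpha M f).coeff w ∈ coeffSpan T f := by
  have hsum : compAlpha M f =
      ∑ s ∈ f.support, AddMonoidAlgebra.single (M.mulVec (castExp s)) (coeff s f) := by
    conv_lhs => rw [← monoMap_toLaurent, f.as_sum]
    simp only [map_sum, toLaurent_monomial, monoMap_single]
  classical
  simp only [hsum, AddMonoidAlgebra.coeff_sum, Finsupp.finsetSum_apply,
    AddMonoidAlgebra.coeff_single, Finsupp.single_apply]
  refine Submodule.sum_mem _ fun s _ => ?_
  split_ifs
  exacts [coeff_mem_coeffSpan T f s, zero_mem _]

theorem compAlpha_one : compAlpha (1 : Matrix (Fin m) (Fin m) ℤ) = toLaurent := by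
  refine MvPolynomial.algHom_ext fun k => ?_
  rw [compAlpha, toLaurent, aeval_X, aeval_X, ← Matrix.mulVec_single_one, Matrix.one_mulVec]

theorem coeff_compAlpha_mulVec (hM : Function.Injective M.mulVec) (f : MvPolynomial (Fin m) ℂ)
    (s : Fin m →₀ ℕ) : (compAlpha M f).coeff (M.mulVec (castExp s)) = f.coeff s := by
  rw [← coeff_toLaurent, ← monoMap_toLaurent]
  exact Finsupp.mapDomain_apply hM _ _

theorem coeffSpan_le_comap_mul_left (T : Type*) [CommRing T] [Algebra T ℂ] {v : Fin m → ℤ} {c : ℂ}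
    (h : compAlpha M Δ₁ = AddMonoidAlgebra.single v c * toLaurent Δ₂) :
    coeffSpan T Δ₂ ≤ (coeffSpan T Δ₁).comap (LinearMap.mulLeft T c) := by
  refine coeffSpan_le_iff.mpr fun s => ?_
  have hcoeff := coeff_compAlpha_mem_coeffSpan T M Δ₁ (v + castExp s)
  rwa [h, AddMonoidAlgebra.coeff_single_mul_add, coeff_toLaurent] at hcoeff

theorem coeffSpan_le_comap_mul_left_inv (T : Type*) [CommRing T] [Algebra T ℂ]
    (hM : Function.Injective M.mulVec) {v : Fin m → ℤ} {c : ℂ} (hc : c ≠ 0)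
    (h : compAlpha M Δ₁ = AddMonoidAlgebra.single v c * toLaurent Δ₂) :
    coeffSpan T Δ₁ ≤ (coeffSpan T Δ₂).comap (LinearMap.mulLeft T c⁻¹) := by
  refine coeffSpan_le_iff.mpr fun s => ?_
  rw [Submodule.mem_comap, LinearMap.mulLeft_apply, ← coeff_compAlpha_mulVec hM, h,
    AddMonoidAlgebra.coeff_single_mul_apply, inv_mul_cancel_left₀ hc, ← compAlpha_one]
  exact coeff_compAlpha_mem_coeffSpan T 1 Δ₂ _

theorem eq_one_or_eq_neg_one_of_isIntegral {q : ℚ} (hq : IsIntegral ℤ q) (hq' : IsIntegral ℤ q⁻¹)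
    (hq₀ : q ≠ 0) : q = 1 ∨ q = -1 := by
  obtain ⟨a, rfl⟩ := IsIntegrallyClosed.isIntegral_iff.mp hq
  obtain ⟨b, hb⟩ := IsIntegrallyClosed.isIntegral_iff.mp hq'
  have hab : a * b = 1 := by
    have hmul := mul_inv_cancel₀ hq₀
    rw [← hb, ← map_mul] at hmul
    exact FaithfulSMul.algebraMap_injective ℤ ℚ (hmul.trans (map_one _).symm)
  rcases Int.eq_one_or_neg_one_of_mul_eq_one hab with rfl | rfl <;> simp

theorem prod_hom_sq_eq_one {Γ A : Type*} [CommGroup Γ] [Fintype Γ] [CommMonoid A] (χ : Γ →* A) :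
    (∏ g, χ g) ^ 2 = 1 := by
  rw [sq]
  nth_rw 1 [← Equiv.prod_comp (Equiv.inv Γ) χ]
  rw [← Finset.prod_mul_distrib]
  simp [← map_mul]

theorem degree_scale (ord : MonomialOrder (Fin m)) (ε : Fin m → ℂˣ) (f : MvPolynomial (Fin m) ℂ) :
    ord.degree (scale ε f) = ord.degree f := by
  have hsupport : (scale ε f).support = f.support := by
    ext s
    rw [mem_support_iff, mem_support_iff, coeff_scale, mul_ne_zero_iff_left (Units.ne_zero _)]
  rw [MonomialOrder.degree, MonomialOrder.degree, hsupport]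

/-- The character `ε ↦ ∏ k, ε_k ^ s_k` of `G_M`. -/
def torusCharacter (M : Matrix (Fin m) (Fin m) ℤ) (s : Fin m →₀ ℕ) : G M →* ℂˣ where
  toFun ε := ∏ k, (ε : Fin m → ℂˣ) k ^ s k
  map_one' := by simp
  map_mul' ε ε' := by simp [mul_pow, Finset.prod_mul_distrib]

theorem leadingCoeff_scaleProd [Fintype (G M)] (ord : MonomialOrder (Fin m))
    {f : MvPolynomial (Fin m) ℂ} (hf : f ≠ 0) :
    ord.leadingCoeff (scaleProd M f) = ord.leadingCoeff f ^ Fintype.card (G M) ∨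
      ord.leadingCoeff (scaleProd M f) = -ord.leadingCoeff f ^ Fintype.card (G M) := by
  have hlead (ε : G M) : ord.leadingCoeff (scale ε f) =
      (torusCharacter M (ord.degree f) ε : ℂ) * ord.leadingCoeff f := by
    rw [MonomialOrder.leadingCoeff, degree_scale, coeff_scale]
    rfl
  have hregular (ε : G M) : _root_.IsRegular (ord.leadingCoeff (scale ε f)) :=
    .of_ne_zero (by simp [hlead, hf])
  rw [scaleProd, ord.leadingCoeff_prod_of_regular fun ε _ => hregular ε]
  simp only [hlead, Finset.prod_mul_distrib, Finset.prod_const, Finset.card_univ]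
  have hsq : (∏ ε : G M, (torusCharacter M (ord.degree f) ε : ℂ)) ^ 2 = 1 :=
    prod_hom_sq_eq_one ((Units.coeHom ℂ).comp (torusCharacter M (ord.degree f)))
  rcases sq_eq_one_iff.mp hsq with h | h
  · exact Or.inl (by rw [h, one_mul])
  · exact Or.inr (by rw [h, neg_one_mul])

theorem exists_leadingCoeff_scaleProd_eq_intCast [Fintype (G M)] (ord : MonomialOrder (Fin m))
    {D : MvPolynomial (Fin m) ℤ} (hD : D ≠ 0) :
    ∃ b : ℤ, b ≠ 0 ∧ ord.leadingCoeff (scaleProd M (toComplex D)) = b := by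
  have hf : toComplex D ≠ 0 :=
    (map_ne_zero_iff _ (map_injective _ (RingHom.injective_int _))).mpr hD
  obtain ⟨a, ha⟩ : ∃ a : ℤ, ord.leadingCoeff (toComplex D) = a := ⟨_, coeff_map _ _ _⟩
  have ha₀ : a ^ Fintype.card (G M) ≠ 0 := by
    refine pow_ne_zero _ fun h₀ => ord.leadingCoeff_ne_zero_iff.mpr hf ?_
    rw [ha, h₀, Int.cast_zero]
  rcases leadingCoeff_scaleProd (M := M) ord hf with hlead | hlead
  · exact ⟨_, ha₀, by rw [hlead, ha, Int.cast_pow]⟩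
  · exact ⟨_, neg_ne_zero.mpr ha₀, by rw [hlead, ha, Int.cast_neg, Int.cast_pow]⟩

theorem exists_ratCast_eq_of_compAlpha_eq [Fintype (G M)] {D₁ D₂ : MvPolynomial (Fin m) ℤ}
    (hD₂ : D₂ ≠ 0) {v : Fin m → ℤ} {c : ℂ}
    (h : compAlpha M (toComplex D₁) =
      AddMonoidAlgebra.single v c * toLaurent (scaleProd M (toComplex D₂))) :
    ∃ q : ℚ, (q : ℂ) = c := by
  obtain ⟨b, hb, hlead⟩ :=
    exists_leadingCoeff_scaleProd_eq_intCast (M := M) MonomialOrder.lex hD₂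
  have hint : coeffSpan ℤ (toComplex D₁) ≤ 1 := coeffSpan_le_iff.mpr fun s =>
    Submodule.mem_one.mpr ⟨D₁.coeff s, (coeff_map _ _ _).symm⟩
  obtain ⟨a, ha⟩ := Submodule.mem_one.mp
    (hint (coeffSpan_le_comap_mul_left ℤ h (coeff_mem_coeffSpan ℤ _ _)))
  have hab : (a : ℂ) = c * b := by rw [← hlead]; exact ha
  refine ⟨a / b, ?_⟩
  rw [Rat.cast_div, Rat.cast_intCast, Rat.cast_intCast, hab,
    mul_div_cancel_right₀ _ (Int.cast_ne_zero.mpr hb)]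

theorem eq_one_or_eq_neg_one_of_compAlpha_eq [Fintype (G M)] (hM : Function.Injective M.mulVec)
    {D₁ D₂ : MvPolynomial (Fin m) ℤ} (hD₁ : (D₁.support.gcd fun s => D₁.coeff s) = 1)
    (hD₂ : (D₂.support.gcd fun s => D₂.coeff s) = 1) {v : Fin m → ℤ} {c : ℂ} (hc : c ≠ 0)
    (h : compAlpha M (toComplex D₁) =
      AddMonoidAlgebra.single v c * toLaurent (scaleProd M (toComplex D₂))) :
    c = 1 ∨ c = -1 := by
  have hspan₁ : coeffSpan (integralClosure ℤ ℂ) (toComplex D₁) = 1 :=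
    coeffSpan_map_intCast_eq_one hD₁
  have hspan₂ := coeffSpan_scaleProd_eq_one (M := M) hD₂
  have hone : (1 : ℂ) ∈ (1 : Submodule (integralClosure ℤ ℂ) ℂ) := Submodule.one_le.mp le_rfl
  have hle := coeffSpan_le_comap_mul_left (integralClosure ℤ ℂ) h
  have hle_inv := coeffSpan_le_comap_mul_left_inv (integralClosure ℤ ℂ) hM hc h
  rw [hspan₁, hspan₂] at hle hle_inv
  have hintegral {z : ℂ} (hz : z * 1 ∈ (1 : Submodule (integralClosure ℤ ℂ) ℂ)) :
      IsIntegral ℤ z := by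
    obtain ⟨y, hy⟩ := Submodule.mem_one.mp hz
    rw [← mul_one z, ← hy]
    exact y.2
  have hD₂₀ : D₂ ≠ 0 := by
    rintro rfl
    simp at hD₂
  obtain ⟨q, rfl⟩ := exists_ratCast_eq_of_compAlpha_eq hD₂₀ h
  have hdescent {x : ℚ} (hx : IsIntegral ℤ (x : ℂ)) : IsIntegral ℤ x :=
    (isIntegral_algebraMap_iff (algebraMap ℚ ℂ).injective).mp hx
  have hq' := hintegral (hle_inv hone)
  rw [← Rat.cast_inv] at hq'
  have hq := eq_one_or_eq_neg_one_of_isIntegral (hdescent (hintegral (hle hone))) (hdescent hq')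
    (Rat.cast_ne_zero.mp hc)
  exact_mod_cast hq

end Constant

section Existence

variable {σ : Type*}

theorem associated_of_dvd_of_totalDegree_le {K : Type*} [Field K] {f g : MvPolynomial σ K}
    (hg : g ≠ 0) (hfg : f ∣ g) (hdeg : g.totalDegree ≤ f.totalDegree) : Associated f g := by
  obtain ⟨q, rfl⟩ := hfg
  have hq := right_ne_zero_of_mul hg
  rw [totalDegree_mul_of_isDomain (left_ne_zero_of_mul hg) hq] at hdeg
  have hqC := totalDegree_eq_zero_iff_eq_C.mp (show q.totalDegree = 0 by lia)
  have hc : q.coeff 0 ≠ 0 := fun h0 => hq (by rw [hqC, h0, map_zero])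
  exact associated_mul_unit_right f q (hqC ▸ (isUnit_iff_ne_zero.mpr hc).map C)

/-- Apply to the coefficients of `f` a `K`-linear functional that does not kill all of them. -/
theorem exists_forall_aeval_eq_zero_imp_eval_eq_zero (K : Type*) {L : Type*} [Field K] [Field L]
    [Algebra K L] {f : MvPolynomial σ L} (hf : f ≠ 0) :
    ∃ p : MvPolynomial σ K, p ≠ 0 ∧ p.support ⊆ f.support ∧
      ∀ y : σ → K, aeval (algebraMap K L ∘ y) f = 0 → eval y p = 0 := by
  obtain ⟨s₀, hs₀⟩ := ne_zero_iff.mp hf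
  obtain ⟨φ, hφ⟩ : ∃ φ : Module.Dual K L, φ (f.coeff s₀) ≠ 0 := by
    by_contra! h
    exact hs₀ ((Module.forall_dual_apply_eq_zero_iff K _).mp h)
  let p : MvPolynomial σ K := ∑ s ∈ f.support, monomial s (φ (f.coeff s))
  have hp (s : σ →₀ ℕ) : p.coeff s = φ (f.coeff s) := by
    classical
    simp +contextual [p, coeff_sum, coeff_monomial]
  refine ⟨p, ne_zero_iff.mpr ⟨s₀, by rwa [hp]⟩, fun s hs => ?_, fun y hy => ?_⟩
  · rw [mem_support_iff, hp] at hs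
    exact mem_support_iff.mpr fun h0 => hs (by rw [h0, map_zero])
  · calc
      eval y p = ∑ s ∈ f.support, φ (f.coeff s) * ∏ k ∈ s.support, y k ^ s k := by
        simp only [p, map_sum, eval_monomial, Finsupp.prod]
      _ = φ (aeval (algebraMap K L ∘ y) f) := by
        simp only [aeval_eq_eval, eval_eq, map_sum, Function.comp_apply, ← map_pow, ← map_prod]
        refine Finset.sum_congr rfl fun s _ => ?_
        rw [mul_comm, mul_comm (f.coeff s), ← Algebra.smul_def, map_smul, smul_eq_mul]
      _ = 0 := by rw [hy, map_zero]

theorem vanishingIdeal_range_ratCast :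
    vanishingIdeal ℂ (Set.range fun (v : Fin m → ℚ) k => (v k : ℂ)) = ⊥ := by
  refine le_bot_iff.mp fun F hF => funext_set (fun _ => Set.range ((↑) : ℚ → ℂ))
    (fun _ => Set.infinite_range_of_injective Rat.cast_injective) fun x hx => ?_
  choose v hv using fun k => hx k (Set.mem_univ k)
  rw [map_zero, ← aeval_eq_eval]
  exact hF x ⟨v, funext hv⟩

theorem IsEquation.exists_associated_map_rat {C : Matrix (Fin n) (Fin m) ℤ}
    {Δ : MvPolynomial (Fin m) ℂ} (h : IsEquation C Δ) (hrow : ∀ i, C i ≠ 0) :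
    ∃ p : MvPolynomial (Fin m) ℚ, p ≠ 0 ∧ Associated Δ (map (algebraMap ℚ ℂ) p) := by
  obtain ⟨p, hp, hsupp, heval⟩ :=
    exists_forall_aeval_eq_zero_imp_eval_eq_zero ℚ h.irreducible.ne_zero
  have hinj := (algebraMap ℚ ℂ).injective
  refine ⟨p, hp, associated_of_dvd_of_totalDegree_le
    ((map_ne_zero_iff _ (map_injective _ hinj)).mpr hp) ?_ ?_⟩
  · rw [h.dvd_iff_pullback hrow, pullback_eq_zero_iff hrow vanishingIdeal_range_ratCast]
    rintro _ ⟨v, rfl⟩ hv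
    have hrat : psiAt C (fun k => (v k : ℂ)) = algebraMap ℚ ℂ ∘ psiAt C v :=
      funext fun k => (map_psiAt (algebraMap ℚ ℂ) C v k).symm
    have hΔ := h.dvd_iff.mp dvd_rfl _ hv
    rw [hrat] at hΔ ⊢
    rw [aeval_map_algebraMap, aeval_algebraMap_apply, aeval_eq_eval, heval _ hΔ, map_zero]
  · exact totalDegree_le_of_support_subset ((support_map_of_injective p hinj).trans_subset hsupp)

theorem exists_eq_C_mul_gcd_eq_one {R : Type*} [CommRing R] [IsDomain R]
    [StrongNormalizedGCDMonoid R] {P : MvPolynomial σ R} (hP : P ≠ 0) :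
    ∃ (r : R) (D : MvPolynomial σ R), P = C r * D ∧
      (D.support.gcd fun s => D.coeff s) = 1 := by
  obtain ⟨D, hD⟩ : C (P.support.gcd fun s => P.coeff s) ∣ P :=
    (C_dvd_iff_dvd_coeff _ _).mpr fun s => by
      by_cases hs : s ∈ P.support
      · exact Finset.gcd_dvd hs
      · rw [notMem_support_iff.mp hs]
        exact dvd_zero _
  refine ⟨_, D, hD, ?_⟩
  set r := P.support.gcd fun s => P.coeff s with hr
  have hr0 : r ≠ 0 := fun h0 => hP (by rw [hD, h0, map_zero, zero_mul])
  have hsupp : P.support = D.support := by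
    rw [hD, ← smul_eq_C_mul, support_smul_eq hr0]
  have hgcd : r = r * D.support.gcd fun s => D.coeff s := by
    conv_lhs => rw [hr, hsupp, hD]
    simp only [coeff_C_mul, Finset.gcd_mul_left]
    rw [hr, Finset.normalize_gcd]
  exact (mul_eq_left₀ hr0).mp hgcd.symm

theorem exists_associated_map_of_gcd_eq_one {R K : Type*} [CommRing R] [IsDomain R]
    [StrongNormalizedGCDMonoid R] [Field K] [Algebra R K] [IsFractionRing R K]
    {p : MvPolynomial σ K} (hp : p ≠ 0) :
    ∃ D : MvPolynomial σ R, (D.support.gcd fun s => D.coeff s) = 1 ∧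
      Associated p (map (algebraMap R K) D) := by
  let _ : Algebra (MvPolynomial σ R) (MvPolynomial σ K) := algebraMvPolynomial
  obtain ⟨⟨P, _, b, hb, rfl⟩, hP⟩ :=
    IsLocalization.surj ((nonZeroDivisors R).map (C (σ := σ))) p
  have hbK : algebraMap R K b ≠ 0 := IsFractionRing.to_map_ne_zero_of_mem_nonZeroDivisors hb
  simp only [algebraMap_def, map_C] at hP
  have hP0 : map (algebraMap R K) P ≠ 0 := hP ▸ mul_ne_zero hp (by simpa using hbK)
  obtain ⟨r, D, rfl, hD⟩ :=
    exists_eq_C_mul_gcd_eq_one (P := P) fun h0 => hP0 (by rw [h0, map_zero])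
  rw [map_mul, map_C] at hP hP0
  have hunit {a : K} (ha : a ≠ 0) : IsUnit (C (σ := σ) a) := (isUnit_iff_ne_zero.mpr ha).map C
  refine ⟨D, hD, (associated_mul_unit_right p _ (hunit hbK)).trans (hP ▸ ?_)⟩
  exact associated_unit_mul_left _ _ (hunit fun h0 => hP0 (by rw [h0, map_zero, zero_mul]))

theorem IsEquation.isDiscriminant {C : Matrix (Fin n) (Fin m) ℤ} {Δ : MvPolynomial (Fin m) ℂ}
    (h : IsEquation C Δ) {D : MvPolynomial (Fin m) ℤ} (hass : Associated Δ (toComplex D))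
    (hD : (D.support.gcd fun s => D.coeff s) = 1) : IsDiscriminant C D := by
  refine ⟨hass.irreducible_iff.mp h.irreducible, ?_, hD⟩
  rw [S, h.vanishingIdeal_eq, Ideal.span_singleton_eq_span_singleton.mpr hass, zeroLocus_span]
  simp [aeval_eq_eval]

theorem IsEquation.exists_isDiscriminant {C : Matrix (Fin n) (Fin m) ℤ}
    {Δ : MvPolynomial (Fin m) ℂ} (h : IsEquation C Δ) (hrow : ∀ i, C i ≠ 0) :
    ∃ D, IsDiscriminant C D := by
  obtain ⟨p, hp, hΔp⟩ := h.exists_associated_map_rat hrow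
  obtain ⟨D, hD, hpD⟩ := exists_associated_map_of_gcd_eq_one (R := ℤ) hp
  refine ⟨D, h.isDiscriminant (hΔp.trans ?_) hD⟩
  have hmap := hpD.map (map (algebraMap ℚ ℂ))
  rwa [map_map, RingHom.eq_intCast' ((algebraMap ℚ ℂ).comp (algebraMap ℤ ℚ))] at hmap

end Existence

section Assembly

variable {C : Matrix (Fin n) (Fin m) ℤ} {M : Matrix (Fin m) (Fin m) ℤ}

theorem IsEquation.mulVec_injective_of_mul {Δ : MvPolynomial (Fin m) ℂ}
    (h : IsEquation (C * M) Δ) (hmn : m ≤ n) (hrow : ∀ i, (C * M) i ≠ 0)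
    (hreg : IsRegular (C * M)) : Function.Injective M.mulVec := by
  obtain ⟨k, -⟩ := exists_mem_vars_of_irreducible h.irreducible
  have : NeZero n := ⟨(k.pos.trans_le hmn).ne'⟩
  have hcomp : (C * M).mulVec = C.mulVec ∘ M.mulVec :=
    funext fun x => (Matrix.mulVec_mulVec x C M).symm
  exact (hcomp ▸ h.mulVec_injective hrow hreg).of_comp

theorem IsDiscriminant.exists_compAlpha_eq {Δ₁ Δ₂ : MvPolynomial (Fin m) ℤ}
    (h₁ : IsDiscriminant (C * M) Δ₁) (h₂ : IsDiscriminant C Δ₂) (hrow : ∀ i, C i ≠ 0)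
    (hreg : IsRegular C) (hM : Function.Injective M.mulVec) :
    ∃ v ∈ columnLattice M, ∃ s : ℤ, (s = 1 ∨ s = -1) ∧
      compAlpha M (toComplex Δ₁) =
        (s : Laurent m) * mono v * ∏ᶠ ε : G M, toLaurent (scale ε (toComplex Δ₂)) := by
  have := finite_G hM
  cases nonempty_fintype (G M)
  obtain ⟨v, hv, c, hc, h⟩ :=
    HornKapranov.exists_compAlpha_eq h₁.isEquation h₂.isEquation hrow hreg hM
  refine ⟨v, hv, ?_⟩
  simp only [h, finprod_eq_prod_of_fintype, ← map_prod, scaleProd]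
  obtain rfl | rfl := eq_one_or_eq_neg_one_of_compAlpha_eq hM h₁.2.2 h₂.2.2 hc h
  · exact ⟨1, .inl rfl, by rw [Int.cast_one, one_mul, mono]⟩
  · exact ⟨-1, .inr rfl, by rw [Int.cast_neg, Int.cast_one, neg_one_mul, mono,
      AddMonoidAlgebra.single_neg]⟩

end Assembly

end HornKapranov

theorem mainTheorem2 (n m : ℕ) (hmn : m ≤ n)
    (C₁ C₂ : Matrix (Fin n) (Fin m) ℤ) (M : Matrix (Fin m) (Fin m) ℤ)
    (hrow₁ : ∀ i, C₁ i ≠ 0) (hrow₂ : ∀ i, C₂ i ≠ 0)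
    (hreg₁ : HornKapranov.IsRegular C₁) (hreg₂ : HornKapranov.IsRegular C₂)
    (hnd₁ : HornKapranov.NonDefective C₁) (hnd₂ : HornKapranov.NonDefective C₂)
    (hM : C₁ = C₂ * M) :
    -- the group is finite, and the two descriptions of the lattice agree
    Finite (HornKapranov.G M) ∧
    (∀ w : Fin m → ℤ,
      w ∈ HornKapranov.columnLattice M ↔ ∀ ε ∈ HornKapranov.G M, ∏ i, ε i ^ w i = 1) ∧
    -- the two discriminants exist
    (∃ Δ₁, HornKapranov.IsDiscriminant C₁ Δ₁) ∧
    (∃ Δ₂, HornKapranov.IsDiscriminant C₂ Δ₂) ∧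
    -- the factorization, for any choice of their signs
    ∀ Δ₁ Δ₂ : MvPolynomial (Fin m) ℤ,
      HornKapranov.IsDiscriminant C₁ Δ₁ → HornKapranov.IsDiscriminant C₂ Δ₂ →
      (∃ v ∈ HornKapranov.columnLattice M, ∃ s : ℤ, (s = 1 ∨ s = -1) ∧
        HornKapranov.compAlpha M (HornKapranov.toComplex Δ₁) =
          (s : HornKapranov.Laurent m) * HornKapranov.mono v *
            ∏ᶠ ε : HornKapranov.G M, HornKapranov.toLaurent
              (HornKapranov.scale (ε : Fin m → ℂˣ) (HornKapranov.toComplex Δ₂))) ∧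
      (∀ ε ∈ HornKapranov.G M, ∀ ε' ∈ HornKapranov.G M, ε ≠ ε' →
        IsRelPrime (HornKapranov.scale ε (HornKapranov.toComplex Δ₂))
          (HornKapranov.scale ε' (HornKapranov.toComplex Δ₂))) ∧
      (∀ ε ∈ HornKapranov.G M,
        emultiplicity
          (HornKapranov.toLaurent
            (HornKapranov.scale ε (HornKapranov.toComplex Δ₂)))
          (HornKapranov.compAlpha M (HornKapranov.toComplex Δ₁)) = 1) := by
  subst hM
  obtain ⟨F₁, hF₁⟩ := hnd₁.exists_isEquation hrow₁
  obtain ⟨F₂, hF₂⟩ := hnd₂.exists_isEquation hrow₂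
  have hinj : Function.Injective M.mulVec := hF₁.mulVec_injective_of_mul hmn hrow₁ hreg₁
  refine ⟨HornKapranov.finite_G hinj, fun w => HornKapranov.mem_columnLattice_iff_forall_mem_G hinj,
    hF₁.exists_isDiscriminant hrow₁, hF₂.exists_isDiscriminant hrow₂, fun Δ₁ Δ₂ h₁ h₂ => ?_⟩
  exact ⟨h₁.exists_compAlpha_eq h₂ hrow₂ hreg₂ hinj,
    fun ε _ ε' _ => h₂.isEquation.isRelPrime_scale hrow₂ hreg₂,
    fun ε => HornKapranov.emultiplicity_compAlpha_eq_one h₁.isEquation h₂.isEquation hrow₂ hreg₂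
      hinj⟩
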